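/- Let $M\ge 1$ and $s\ge 1$ be integers, $\Phi\in\mathbb R^{M\times N}$, and let $D\in\mathbb R^{N\times d}$ be a tight frame: its columns $D_1,\dots,D_d$ satisfy $\sum_i\langle f,D_i\rangle D_i=f$ and $\sum_i|\langle f,D_i\rangle|^2=\|f\|_2^2$ for all $f\in\mathbb R^N$ (equivalently $DD^*=I$, where $*$ denotes the transpose). A vector is $k$-sparse if it has at most $k$ nonzero entries. For an integer $k\ge 1$ the $D$-RIP constant $\delta_k$ of $\Phi$ is the smallest $\delta\ge 0$ such that $\sqrt{1-\delta}\,\|Dx\|_2\le\|\Phi Dx\|_2\le\sqrt{1+\delta}\,\|Dx\|_2$ for all $k$-sparse $x\in\mathbb R^d$ (with $\sqrt{1-\delta}$ read as $0$ if $\delta>1$); for real $r>0$ put $\delta_r=\delta_{\lceil r\rceil}$. For $x\in\mathbb R^d$ let $x_{[s]}$ be a minimizer of $\|x-y\|_2$ over all $s$-sparse $y$. For $b\in\mathbb R^M$ and $\mathcal B\subseteq\mathbb R^M$, the $\ell_1$-analysis problem over $\mathcal B$ is: minimize $\|D^*g\|_1$ over $g\in\mathbb R^N$ subject to $\Phi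 g-b\in\mathcal B$. Let $0<t<4/3$ with $ts>1$, and suppose that $\delta:=\delta_{ts}<t/(4-t)$. Let $\sigma\ge 0$, let $z\sim N(0,\sigma^2I)$ be a Gaussian random vector in $\mathbb R^M$, let $f\in\mathbb R^N$ and $b=\Phi f+z$. Put $$\mathcal B_2=\{w:\|w\|_2^2\le\sigma^2(M+2\sqrt{M\log M})\},\qquad \mathcal B_3=\{w:\|D^*\Phi^*w\|_\infty^2\le 8\sigma^2\log d\},$$ and, with $\tilde t=\max\{t,\sqrt t\}$, $$A=\frac{2\sqrt2\sqrt{1+\delta}\,\tilde t}{t+(t-4)\delta},\quad B=\frac{4\sqrt2\,\delta+2\sqrt2\sqrt{(t+(t-4)\delta)\delta}}{t+(t-4)\delta}+\frac{\sqrt2}{2},\quad C=\frac{2\sqrt{2s}\,\tilde t}{t+(t-4)\delta}.$$ Then: (1) With probability at least $1-1/M$, the $\ell_1$-analysis problem over $\mathcal B_2$ has a solution, and every solution $\tilde f_1$ satisfies $$\|\tilde f_1-f\|_2\le A\sigma\sqrt{M+2\sqrt{M\log M}}+B\,\frac{\|D^*f-(D^*f)_{[s]}\|_1}{\sqrt s}.$$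 (2) If $d\ge2$, then with probability at least $1-1/(d\sqrt{2\pi\log d})$, the $\ell_1$-analysis problem over $\mathcal B_3$ has a solution, and every solution $\tilde f_2$ satisfies $$\|\tilde f_2-f\|_2\le 2\sqrt2\,C\sigma\sqrt{\log d}+B\,\frac{\|D^*f-(D^*f)_{[s]}\|_1}{\sqrt s}.$$ -/

import Mathlib

open scoped ENNReal NNReal Matrix
open MeasureTheory ProbabilityTheory

namespace L1Analysis

/-- The `ℓ_p` norm of a vector `v ∈ ℝⁿ`: `‖v‖₁ = ∑ |v i|` for `p = 1`, the Euclidean norm for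
`p = 2`, and `max |v i|` for `p = ∞`. -/
noncomputable def lpNorm {n : ℕ} (p : ℝ≥0∞) (v : Fin n → ℝ) : ℝ :=
  ‖WithLp.toLp p v‖

/-- The columns `D₁, …, D_d` of the `N × d` matrix `D` form a (Parseval) tight frame:
`∑ᵢ ⟨f, Dᵢ⟩ Dᵢ = f` and `∑ᵢ |⟨f, Dᵢ⟩|² = ‖f‖₂²` for all `f ∈ ℝᴺ`. -/
def IsTightFrame {N d : ℕ} (D : Matrix (Fin N) (Fin d) ℝ) : Prop :=
  ∀ f : Fin N → ℝ,
    ∑ i, (f ⬝ᵥ D.col i) • D.col i = f ∧ ∑ i, |f ⬝ᵥ D.col i| ^ 2 = lpNorm 2 f ^ 2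

/-- `x` is `k`-sparse: it has at most `k` nonzero entries. -/
def IsSparse {n : ℕ} (k : ℕ) (x : Fin n → ℝ) : Prop :=
  hammingNorm x ≤ k

/-- `Φ` satisfies the restricted isometry property adapted to `D` of order `k` with
constant `δ`. -/
def DRIP {M N d : ℕ} (Φ : Matrix (Fin M) (Fin N) ℝ) (D : Matrix (Fin N) (Fin d) ℝ)
    (k : ℕ) (δ : ℝ) : Prop :=
  ∀ x : Fin d → ℝ, IsSparse k x →
    √(1 - δ) * lpNorm 2 (D *ᵥ x) ≤ lpNorm 2 (Φ *ᵥ (D *ᵥ x)) ∧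
      lpNorm 2 (Φ *ᵥ (D *ᵥ x)) ≤ √(1 + δ) * lpNorm 2 (D *ᵥ x)

/-- The `D`-RIP constant of order `k`: the smallest `δ ≥ 0` for which `DRIP Φ D k δ` holds.
(If `D x ≠ 0` for some `k`-sparse `x`, then every `δ` with `DRIP Φ D k δ` is nonnegative.) -/
noncomputable def dripConst {M N d : ℕ} (Φ : Matrix (Fin M) (Fin N) ℝ)
    (D : Matrix (Fin N) (Fin d) ℝ) (k : ℕ) : ℝ :=
  sInf {δ : ℝ | 0 ≤ δ ∧ DRIP Φ D k δ}

/-- The `D`-RIP constant `δ_r` of real order `r`, that is, of order `⌈r⌉`. -/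
noncomputable def dripConstReal {M N d : ℕ} (Φ : Matrix (Fin M) (Fin N) ℝ)
    (D : Matrix (Fin N) (Fin d) ℝ) (r : ℝ) : ℝ :=
  dripConst Φ D ⌈r⌉₊

/-- `y` is a best `s`-term approximation `x_{[s]}` of `x`: a minimizer of `‖x - y‖₂` over all
`s`-sparse `y`, i.e. `y` keeps `s` entries of `x` of largest absolute value. -/
def IsBestApprox {n : ℕ} (s : ℕ) (x y : Fin n → ℝ) : Prop :=
  IsSparse s y ∧ ∀ y' : Fin n → ℝ, IsSparse s y' → lpNorm 2 (x - y) ≤ lpNorm 2 (x - y')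

/-- `g` solves the `ℓ₁`-analysis problem: minimize `‖D* g‖₁` over `g ∈ ℝᴺ` subject to
`Φ g - b ∈ B`. -/
def IsL1AnalysisSolution {M N d : ℕ} (Φ : Matrix (Fin M) (Fin N) ℝ)
    (D : Matrix (Fin N) (Fin d) ℝ) (b : Fin M → ℝ) (B : Set (Fin M → ℝ))
    (g : Fin N → ℝ) : Prop :=
  Φ *ᵥ g - b ∈ B ∧
    ∀ g' : Fin N → ℝ, Φ *ᵥ g' - b ∈ B → lpNorm 1 (Dᵀ *ᵥ g) ≤ lpNorm 1 (Dᵀ *ᵥ g')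

/-- The constraint set `{z ∈ ℝᴹ : ‖z‖₂² ≤ σ² (M + 2 √(M log M))}`. -/
def setB₂ (M : ℕ) (σ : ℝ) : Set (Fin M → ℝ) :=
  {z | lpNorm 2 z ^ 2 ≤ σ ^ 2 * (M + 2 * √(M * Real.log M))}

/-- The constraint set `{z ∈ ℝᴹ : ‖D* Φ* z‖_∞² ≤ 8 σ² log d}`. -/
def setB₃ {M N d : ℕ} (Φ : Matrix (Fin M) (Fin N) ℝ) (D : Matrix (Fin N) (Fin d) ℝ)
    (σ : ℝ) : Set (Fin M → ℝ) :=
  {z | lpNorm ∞ (Dᵀ *ᵥ (Φᵀ *ᵥ z)) ^ 2 ≤ 8 * σ ^ 2 * Real.log d}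

/-- `A = 2√2 √(1+δ) max{t, √t} / (t + (t-4) δ)`. -/
noncomputable def constA (t δ : ℝ) : ℝ :=
  2 * √2 * √(1 + δ) * max t (√t) / (t + (t - 4) * δ)

/-- `B = (4√2 δ + 2√2 √((t + (t-4) δ) δ)) / (t + (t-4) δ) + √2 / 2`. -/
noncomputable def constB (t δ : ℝ) : ℝ :=
  (4 * √2 * δ + 2 * √2 * √((t + (t - 4) * δ) * δ)) / (t + (t - 4) * δ) + √2 / 2

/-- `C = 2 √(2s) max{t, √t} / (t + (t-4) δ)`. -/
noncomputable def constC (s : ℕ) (t δ : ℝ) : ℝ :=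
  2 * √(2 * s) * max t (√t) / (t + (t - 4) * δ)

/-- The law `N(0, σ² I)` on `ℝᴹ`: independent centred Gaussian coordinates of variance `σ²`. -/
noncomputable def gaussianNoise (M : ℕ) (σ : ℝ≥0) : Measure (Fin M → ℝ) :=
  Measure.pi fun _ => gaussianReal 0 (σ ^ 2)

/-- `P` holds with probability at least `p`: it holds on all of some event of probability
at least `p`. -/
def HoldsWithProb {Ω : Type*} [MeasurableSpace Ω] (μ : Measure Ω) (p : ℝ)
    (P : Ω → Prop) : Prop :=
  ∃ E : Set Ω, MeasurableSet E ∧ p ≤ μ.real E ∧ ∀ ω ∈ E, P ω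

end L1Analysis

/-! Put m = ⌈ts⌉ and B(x,y) = ⟨ΦDx,ΦDy⟩ − ⟨Dx,Dy⟩. As ‖Dx‖ ≤ ‖x‖ for a tight frame, the D-RIP gives
|B(x,x)| ≤ δ‖x‖² on m-sparse x. For a solution g let h = g − f and c = D*h, let T carry the s
largest |c i|, and let x = c_T, X = ‖x‖. Since DD* = I, B(x,c) = ⟨ΦDx,Φh⟩ − X². Feasibility of f and
g bounds the first term by νX, so a lower bound for B(x,c) controls X; this is `neg_bilin_restr_le`.

Minimality of g gives the cone condition, hence an α with ‖c_{Tᶜ}‖_∞ ≤ α and ‖c_{Tᶜ}‖₁ ≤ sα. Such a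
tail is a convex combination of b-sparse vectors u (`mem_of_sparse_mem`). For S ⊆ T with |S| = a and
a + b ≤ m, the form is bounded at c_S − τu and c_S + βu. A weighted difference of the two bounds
cancels B(u,u); what remains is affine in u and passes to the tail (`bilin_restr_pair_le`).
Averaging over all S of size a replaces c_S by x (`exists_average_bilin`). The ideal ratio is τ/β =
3 with τ + β = t, possible with τ ≤ 1 when t ≤ 4/3; since sizes are integers, ratio 3 is reached by
combining other inequalities.

The outcome is a quadratic inequality in X with leading coefficient t + (t−4)δ, positive exactly
when δ < t/(4−t). As ‖h‖ = ‖c‖, bounding the tail by X as well yields `DRIP.lpNorm_le_of_cone`.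

It remains to see that the noise lies in the constraint set with the stated probability. For 𝓑₂ the
χ² tail is compared with Γ(M/2) by Stirling (`radial_ratio_le`); for 𝓑₃ a union bound over the d
Gaussian coordinates of D*Φ*z suffices. -/

namespace L1Analysis

/-! ### Convex hulls of sparse vectors. -/

/-- A point of the cube `[0,1]^ι` whose coordinates sum to at most `b` lies in every convex set
containing the indicators of the sets with at most `b` elements. -/
theorem mem_of_indicator_mem {ι : Type*} [Fintype ι] [DecidableEq ι] {b : ℕ} {C : Set (ι → ℝ)}
    (hC : Convex ℝ C)
    (hb : ∀ S : Finset ι, S.card ≤ b → (fun i => if i ∈ S then (1 : ℝ) else 0) ∈ C)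
    (w : ι → ℝ) (h0 : ∀ i, 0 ≤ w i) (h1 : ∀ i, w i ≤ 1) (hs : ∑ i, w i ≤ b) : w ∈ C := by
  induction hn : (Finset.univ.filter fun i => w i ≠ 0 ∧ w i ≠ 1).card using
    Nat.strong_induction_on generalizing w with
  | _ n ih =>
  set F := Finset.univ.filter fun i => w i ≠ 0 ∧ w i ≠ 1 with hF
  -- Between two fractional coordinates, mass can be moved both ways until one of them becomes 0 or
  -- 1, so `w` lies between two points with fewer fractional coordinates. If at most one is left,
  -- integrality of `b` leaves room to round it up.
  rcases Nat.lt_or_ge 1 F.card with hc | hc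
  · obtain ⟨i, hi, j, hj, hij⟩ := Finset.one_lt_card.1 hc
    rw [hF, Finset.mem_filter] at hi hj
    -- moving mass `e` from `j` to `i`
    let m : ℝ → ι → ℝ := fun e => Function.update (Function.update w i (w i + e)) j (w j - e)
    have mi : ∀ e, m e i = w i + e := fun e => by simp [m, hij]
    have mj : ∀ e, m e j = w j - e := fun e => by simp [m]
    have mo : ∀ e l, l ≠ i → l ≠ j → m e l = w l := fun e l h h' => by simp [m, h, h']
    have msum : ∀ e, ∑ l, m e l = ∑ l, w l := by
      intro e
      have : ∀ l, m e l = w l + (if l = i then e else 0) - (if l = j then e else 0) := by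
        intro l
        by_cases h : l = i
        · subst h; simp [mi, hij]
        · by_cases h' : l = j
          · subst h'; simp [mj, h]
          · simp [mo e l h h', h, h']
      simp [this, Finset.sum_add_distrib, Finset.sum_sub_distrib]
    have key : ∀ e, 0 ≤ w i + e → w i + e ≤ 1 → 0 ≤ w j - e → w j - e ≤ 1 →
        (w i + e = 0 ∨ w i + e = 1 ∨ w j - e = 0 ∨ w j - e = 1) → m e ∈ C := by
      intro e e1 e2 e3 e4 e5
      refine ih _ ?_ (m e) ?_ ?_ ?_ rfl
      · rw [← hn]
        apply Finset.card_lt_card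
        refine ⟨fun l hl => ?_, fun hsub => ?_⟩
        · rw [Finset.mem_filter] at hl
          rw [hF, Finset.mem_filter]
          by_cases h : l = i
          · subst h; exact hi
          · by_cases h' : l = j
            · subst h'; exact hj
            · rwa [mo e l h h'] at hl
        · have hi' := hsub (show i ∈ F by rw [hF, Finset.mem_filter]; exact hi)
          have hj' := hsub (show j ∈ F by rw [hF, Finset.mem_filter]; exact hj)
          simp only [Finset.mem_filter, mi, mj] at hi' hj'
          tauto
      · intro l
        by_cases h : l = i
        · subst h; rwa [mi]
        · by_cases h' : l = j
          · subst h'; rwa [mj]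
          · rw [mo e l h h']; exact h0 l
      · intro l
        by_cases h : l = i
        · subst h; rwa [mi]
        · by_cases h' : l = j
          · subst h'; rwa [mj]
          · rw [mo e l h h']; exact h1 l
      · rw [msum]; exact hs
    have pi0 : 0 < w i := lt_of_le_of_ne (h0 i) (Ne.symm hi.2.1)
    have pj0 : 0 < w j := lt_of_le_of_ne (h0 j) (Ne.symm hj.2.1)
    have pi1 : w i < 1 := lt_of_le_of_ne (h1 i) hi.2.2
    have pj1 : w j < 1 := lt_of_le_of_ne (h1 j) hj.2.2
    have up : ∃ e > 0, m e ∈ C := by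
      rcases le_total (1 - w i) (w j) with h | h
      · exact ⟨1 - w i, by linarith, key _ (by linarith) (by linarith) (by linarith) (by linarith)
          (Or.inr (Or.inl (by ring)))⟩
      · exact ⟨w j, pj0, key _ (by linarith) (by linarith) (by linarith) (by linarith)
          (Or.inr (Or.inr (Or.inl (by ring))))⟩
    have dn : ∃ e > 0, m (-e) ∈ C := by
      rcases le_total (w i) (1 - w j) with h | h
      · exact ⟨w i, pi0, key _ (by linarith) (by linarith) (by linarith) (by linarith)
          (Or.inl (by ring))⟩
      · exact ⟨1 - w j, by linarith, key _ (by linarith) (by linarith) (by linarith) (by linarith)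
          (Or.inr (Or.inr (Or.inr (by ring))))⟩
    obtain ⟨e, he, hm⟩ := up
    obtain ⟨e', he', hm'⟩ := dn
    have hne : e + e' ≠ 0 := by positivity
    have := hC hm hm' (a := e' / (e + e')) (b := e / (e + e')) (by positivity) (by positivity)
      (by field_simp; ring)
    convert this using 1
    funext l
    simp only [Pi.add_apply, Pi.smul_apply, smul_eq_mul]
    by_cases h : l = i
    · subst h; rw [mi, mi]; field_simp; ring
    · by_cases h' : l = j
      · subst h'; rw [mj, mj]; field_simp; ring
      · rw [mo _ l h h', mo _ l h h']; field_simp; ring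
  · set O := Finset.univ.filter fun i => w i = 1 with hO
    have hval : ∀ l, l ∉ F → w l = if l ∈ O then 1 else 0 := by
      intro l hl
      by_cases h : w l = 1
      · simp [hO, h]
      · have : w l = 0 := by
          by_contra h'
          exact hl (by simp [hF, h, h'])
        simp [hO, this]
    have hOsum : (O.card : ℝ) + ∑ i ∈ F, w i ≤ b := by
      have hd : Disjoint O F := by
        rw [Finset.disjoint_left]; intro l h h'
        simp only [hO, hF, Finset.mem_filter] at h h'
        exact h'.2.2 h.2
      have : (O.card : ℝ) = ∑ i ∈ O, w i := by
        rw [Finset.sum_congr rfl (fun l hl => (Finset.mem_filter.1 hl).2)]; simp [← hO]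
      rw [this, ← Finset.sum_union hd]
      exact (Finset.sum_le_sum_of_subset_of_nonneg (Finset.subset_univ _) fun i _ _ => h0 i).trans hs
    rcases Nat.eq_zero_or_pos F.card with hz | hp
    · rw [Finset.card_eq_zero] at hz
      rw [hz] at hval hOsum
      have hOb : O.card ≤ b := by
        have : (O.card : ℝ) ≤ b := by simpa using hOsum
        exact_mod_cast this
      convert hb O hOb using 1
      funext l
      exact hval l (by simp)
    · obtain ⟨i, hi⟩ := Finset.card_eq_one.1 (le_antisymm hc hp)
      have hiF : i ∈ F := by simp [hi]
      have hi2 := (Finset.mem_filter.1 hiF).2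
      have hiO : i ∉ O := by simp [hO, hi2.2]
      have pi0 : 0 < w i := lt_of_le_of_ne (h0 i) (Ne.symm hi2.1)
      have hOb : O.card < b := by
        have : (O.card : ℝ) < b := by
          rw [hi] at hOsum; simp only [Finset.sum_singleton] at hOsum; linarith
        exact_mod_cast this
      have hA := hb O hOb.le
      have hB := hb (insert i O) (by rw [Finset.card_insert_of_notMem hiO]; exact hOb)
      have := hC hA hB (a := 1 - w i) (b := w i) (by linarith [h1 i]) pi0.le (by ring)
      convert this using 1
      funext l
      simp only [Pi.add_apply, Pi.smul_apply, smul_eq_mul]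
      by_cases h : l = i
      · subst h; simp [hiO]
      · rw [hval l (by simp [hi, h])]
        simp only [Finset.mem_insert, h, false_or]
        ring

/-- Sparse representation of a polytope: a vector `v` with `|v i| ≤ r` and `‖v‖₁ ≤ b r` lies in every
convex set containing the `b`-sparse vectors `u` with `|u i| ≤ r`, supported in the support of `v`. -/
theorem mem_of_sparse_mem {ι : Type*} [Fintype ι] [DecidableEq ι] {b : ℕ} {C : Set (ι → ℝ)}
    (hC : Convex ℝ C) (v : ι → ℝ) {r : ℝ} (hv : ∀ i, |v i| ≤ r)
    (hs : ∑ i, |v i| ≤ b * r)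
    (hu : ∀ u : ι → ℝ, (∀ i, v i = 0 → u i = 0) → hammingNorm u ≤ b → (∀ i, |u i| ≤ r) →
      u ∈ C) : v ∈ C := by
  rcases le_or_gt r 0 with hr | hr
  · have : ∀ i, v i = 0 := fun i => abs_eq_zero.1 (le_antisymm ((hv i).trans hr) (abs_nonneg _))
    refine hu v (fun i h => h) ?_ hv
    have : v = 0 := funext this
    simp [this]
  -- Scaling coordinate `i` by `r * sign (v i)` sends `|v| / r` to `v` and indicators of `b`-sets to
  -- admissible sparse vectors.
  · let f : (ι → ℝ) →ₗ[ℝ] (ι → ℝ) :=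
      LinearMap.pi fun i => (r * SignType.sign (v i)) • LinearMap.proj i
    have hf : ∀ w i, f w i = r * SignType.sign (v i) * w i := fun w i => by simp [f]
    have := mem_of_indicator_mem (b := b) (hC.linear_preimage f) (fun S hS => ?_)
      (fun i => |v i| / r) (fun i => by positivity) (fun i => (div_le_one hr).2 (hv i)) ?_
    · have e : f (fun i => |v i| / r) = v := by
        funext i
        rw [hf]
        have := sign_mul_abs (v i)
        field_simp
        simpa [SignType.cast] using this
      have h2 : f (fun i => |v i| / r) ∈ C := this
      rwa [e] at h2
    · refine hu _ (fun i hi => by rw [hf]; simp [hi]) ?_ (fun i => ?_)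
      · refine le_trans (Finset.card_le_card fun i hi => ?_) hS
        by_contra h
        simp [hf, h] at hi
      · rw [hf]
        have h1 : |((SignType.sign (v i) : SignType) : ℝ)| ≤ 1 := by
          rcases lt_trichotomy (v i) 0 with h | h | h <;> simp [h]
        have h2 : |(if i ∈ S then (1 : ℝ) else 0)| ≤ 1 := by split_ifs <;> simp
        rw [abs_mul, abs_mul, abs_of_pos hr]
        calc r * _ * _ ≤ r * 1 * 1 := by gcongr
          _ = r := by ring
    · rw [← Finset.sum_div, div_le_iff₀ hr]; exact hs

/-! ### Averages over subsets of fixed size. -/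

/-- Sum over all `a`-subsets of the sum over the subset. -/
theorem sum_powersetCard_sum {κ : Type*} [DecidableEq κ] (T : Finset κ) {a : ℕ} (ha : 1 ≤ a)
    (f : κ → ℝ) :
    (T.card : ℝ) * ∑ S ∈ T.powersetCard a, ∑ i ∈ S, f i =
      (T.card.choose a) * (a * ∑ i ∈ T, f i) := by
  have h1 : ∑ S ∈ T.powersetCard a, ∑ i ∈ S, f i =
      ∑ i ∈ T, ∑ S ∈ T.powersetCard a with i ∈ S, f i := by
    refine Finset.sum_comm' fun S i => ?_
    simp only [Finset.mem_powersetCard, Finset.mem_filter]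
    constructor
    · rintro ⟨⟨h, h'⟩, h''⟩; exact ⟨⟨⟨h, h'⟩, h''⟩, h h''⟩
    · rintro ⟨⟨⟨h, h'⟩, h''⟩, -⟩; exact ⟨⟨h, h'⟩, h''⟩
  have h2 : ∀ i ∈ T, (T.card : ℝ) * ∑ S ∈ T.powersetCard a with i ∈ S, f i =
      T.card.choose a * a * f i := by
    intro i hi
    have hc := Finset.card_filter_powersetCard_subset {i} T a
      (by simpa using hi) (by simpa using ha)
    simp only [Finset.singleton_subset_iff, Finset.card_singleton] at hc
    rw [Finset.sum_const, hc, nsmul_eq_mul]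
    obtain ⟨k, hk⟩ : ∃ k, T.card = k + 1 :=
      ⟨T.card - 1, by have := Finset.card_pos.2 ⟨i, hi⟩; omega⟩
    obtain ⟨c, rfl⟩ : ∃ c, a = c + 1 := ⟨a - 1, by omega⟩
    rw [hk]
    have := Nat.add_one_mul_choose_eq k c
    have h : ((k + 1 : ℕ) : ℝ) * (k.choose c : ℝ) = (k + 1).choose (c + 1) * (c + 1 : ℕ) := by
      exact_mod_cast this
    simp only [Nat.add_sub_cancel]
    rw [← h]; ring
  rw [h1, Finset.mul_sum, Finset.sum_congr rfl h2, ← Finset.mul_sum]; ring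

/-- Sum over all `a`-subsets of an off-diagonal double sum over the subset. -/
theorem sum_powersetCard_offDiag {κ : Type*} [DecidableEq κ] (T : Finset κ) {a : ℕ} (ha : 1 ≤ a)
    (g : κ × κ → ℝ) :
    (T.card : ℝ) * (T.card - 1) * ∑ S ∈ T.powersetCard a, ∑ i ∈ S.offDiag, g i =
      (T.card.choose a) * (a * (a - 1) * ∑ i ∈ T.offDiag, g i) := by
  rcases Nat.lt_or_ge a 2 with h2 | h2
  · obtain rfl : a = 1 := by omega
    have : ∀ S ∈ T.powersetCard 1, ∑ i ∈ S.offDiag, g i = 0 := by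
      intro S hS
      obtain ⟨i, rfl⟩ := Finset.card_eq_one.1 (Finset.mem_powersetCard.1 hS).2
      simp
    rw [Finset.sum_congr rfl this]; simp
  have h1 : ∑ S ∈ T.powersetCard a, ∑ i ∈ S.offDiag, g i =
      ∑ i ∈ T.offDiag, ∑ S ∈ T.powersetCard a with {i.1, i.2} ⊆ S, g i := by
    refine Finset.sum_comm' fun S i => ?_
    simp only [Finset.mem_powersetCard, Finset.mem_filter, Finset.mem_offDiag,
      Finset.insert_subset_iff, Finset.singleton_subset_iff]
    constructor
    · rintro ⟨⟨h, h'⟩, h1, h2, h3⟩; exact ⟨⟨⟨h, h'⟩, h1, h2⟩, h h1, h h2, h3⟩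
    · rintro ⟨⟨⟨h, h'⟩, h1, h2⟩, -, -, h3⟩; exact ⟨⟨h, h'⟩, h1, h2, h3⟩
  have h2 : ∀ i ∈ T.offDiag, (T.card : ℝ) * (T.card - 1) *
      ∑ S ∈ T.powersetCard a with {i.1, i.2} ⊆ S, g i =
      T.card.choose a * (a * (a - 1)) * g i := by
    intro i hi
    rw [Finset.mem_offDiag] at hi
    have hcard : ({i.1, i.2} : Finset κ).card = 2 := Finset.card_pair hi.2.2
    have hsub : {i.1, i.2} ⊆ T := by
      simp [Finset.insert_subset_iff, hi.1, hi.2.1]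
    have hc := Finset.card_filter_powersetCard_subset {i.1, i.2} T a hsub (by rw [hcard]; exact h2)
    rw [Finset.sum_const, hc, nsmul_eq_mul, hcard]
    obtain ⟨k, hk⟩ : ∃ k, T.card = k + 2 :=
      ⟨T.card - 2, by have := Finset.card_le_card hsub; omega⟩
    obtain ⟨c, rfl⟩ : ∃ c, a = c + 2 := ⟨a - 2, by omega⟩
    rw [hk]
    have e1 : ((k + 1 + 1 : ℕ) : ℝ) * ((k + 1).choose (c + 1) : ℝ) =
        (k + 2).choose (c + 2) * (c + 1 + 1 : ℕ) := by
      exact_mod_cast Nat.add_one_mul_choose_eq (k + 1) (c + 1)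
    have e2 : ((k + 1 : ℕ) : ℝ) * (k.choose c : ℝ) = (k + 1).choose (c + 1) * (c + 1 : ℕ) := by
      exact_mod_cast Nat.add_one_mul_choose_eq k c
    simp only [Nat.add_sub_cancel]
    push_cast at e1 e2 ⊢
    linear_combination g i * (k + 2) * e2 + g i * (c + 1) * e1
  rw [h1, Finset.mul_sum, Finset.sum_congr rfl h2, ← Finset.mul_sum]; ring

/-- A bilinear form at `(∑ wᵢ, ∑ wᵢ)`, split in its diagonal and its off-diagonal part. -/
theorem bilin_sum_sum {κ V : Type*} [DecidableEq κ] [AddCommGroup V] [Module ℝ V]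
    (B : V →ₗ[ℝ] V →ₗ[ℝ] ℝ) (w : κ → V) (S : Finset κ) :
    B (∑ i ∈ S, w i) (∑ i ∈ S, w i) =
      ∑ i ∈ S, B (w i) (w i) + ∑ p ∈ S.offDiag, B (w p.1) (w p.2) := by
  simp only [map_sum, LinearMap.sum_apply]
  rw [Finset.sum_comm, ← Finset.sum_product', ← Finset.diag_union_offDiag,
    Finset.sum_union (Finset.disjoint_diag_offDiag S), Finset.sum_diag]

/-- The average of a quadratic form over the partial sums `∑ i ∈ S, wᵢ` with `|S| = a`. The number
`p` does not depend on `a`; it is controlled by the values of the form at differences `wᵢ - wⱼ`. -/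
theorem exists_average_bilin {κ V : Type*} [DecidableEq κ] [AddCommGroup V] [Module ℝ V]
    (B : V →ₗ[ℝ] V →ₗ[ℝ] ℝ) (hB : ∀ x y, B x y = B y x) (w : κ → V) (T : Finset κ)
    (hT : 1 ≤ T.card)
    {n : κ → ℝ} {δ : ℝ} (h1 : ∀ i ∈ T, |B (w i) (w i)| ≤ δ * n i)
    (h2 : ∀ i ∈ T, ∀ j ∈ T, i ≠ j → |B (w i - w j) (w i - w j)| ≤ δ * (n i + n j)) :
    ∃ p : ℝ, |p| ≤ δ * ∑ i ∈ T, n i ∧ ∀ a : ℕ, 1 ≤ a →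
      ∑ S ∈ T.powersetCard a, B (∑ i ∈ S, w i) (∑ i ∈ S, w i) =
        T.card.choose a * ((a / T.card) * ((1 - a / T.card) * p +
          a / T.card * B (∑ i ∈ T, w i) (∑ i ∈ T, w i))) := by
  set q := ∑ i ∈ T, B (w i) (w i) with hq
  set o := ∑ p ∈ T.offDiag, B (w p.1) (w p.2) with ho
  have hk : (0 : ℝ) < T.card := by exact_mod_cast hT
  have hQ : B (∑ i ∈ T, w i) (∑ i ∈ T, w i) = q + o := bilin_sum_sum B w T
  have hsum : ∀ a : ℕ, 1 ≤ a → ∑ S ∈ T.powersetCard a, B (∑ i ∈ S, w i) (∑ i ∈ S, w i) =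
      T.card.choose a * (a / T.card * q + a * (a - 1) / (T.card * (T.card - 1)) * o) := by
    intro a ha
    simp only [bilin_sum_sum B w]
    rw [Finset.sum_add_distrib]
    have e1 := sum_powersetCard_sum T ha (fun i => B (w i) (w i))
    have e2 := sum_powersetCard_offDiag T ha (fun p => B (w p.1) (w p.2))
    rw [← hq] at e1
    rw [← ho] at e2
    have e1' : ∑ S ∈ T.powersetCard a, ∑ i ∈ S, B (w i) (w i) =
        T.card.choose a * (a / T.card * q) := by field_simp; linarith
    rw [e1', mul_add]
    congr 1
    rcases Nat.lt_or_ge 1 T.card with h | h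
    · have : (0 : ℝ) < T.card - 1 := by
        have : (1 : ℝ) < T.card := by exact_mod_cast h
        linarith
      field_simp; linarith
    · have hc : T.card = 1 := le_antisymm h hT
      have z : ∀ S ∈ T.powersetCard a, ∑ p ∈ S.offDiag, B (w p.1) (w p.2) = 0 := by
        intro S hS
        have := Finset.card_le_card (Finset.mem_powersetCard.1 hS).1
        have := (Finset.mem_powersetCard.1 hS).2
        obtain ⟨i, rfl⟩ := Finset.card_eq_one.1 (show S.card = 1 by omega)
        simp
      rw [Finset.sum_congr rfl z, hc]; simp
  rcases Nat.lt_or_ge 1 T.card with h | h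
  · have hk1 : (0 : ℝ) < T.card - 1 := by
      have : (1 : ℝ) < T.card := by exact_mod_cast h
      linarith
    -- With k = |T|, the diagonal part has average weight a/k and the off-diagonal part
    -- a(a−1)/(k(k−1)), which forces this value. It is also 1/(2(k−1)) times the sum of B(wᵢ − wⱼ,
    -- wᵢ − wⱼ) over ordered pairs, whence the bound.
    refine ⟨q - o / (T.card - 1), ?_, fun a ha => ?_⟩
    · have hd : ∀ f : κ → ℝ, ∑ p ∈ T.offDiag, (f p.1 + f p.2) =
          2 * (T.card - 1) * ∑ i ∈ T, f i := by
        intro f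
        have := Finset.sum_union (Finset.disjoint_diag_offDiag T) (f := fun p => f p.1 + f p.2)
        rw [Finset.diag_union_offDiag, Finset.sum_diag, Finset.sum_product] at this
        simp only [Finset.sum_add_distrib, Finset.sum_const, nsmul_eq_mul, ← Finset.mul_sum]
          at this ⊢
        linarith
      have hs : ∑ p ∈ T.offDiag, B (w p.1 - w p.2) (w p.1 - w p.2) =
          2 * (T.card - 1) * (q - o / (T.card - 1)) := by
        have : ∀ p ∈ T.offDiag, B (w p.1 - w p.2) (w p.1 - w p.2) =
            (B (w p.1) (w p.1) + B (w p.2) (w p.2)) - 2 * B (w p.1) (w p.2) := by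
          intro p _
          simp only [map_sub, LinearMap.sub_apply, hB (w p.2) (w p.1)]; ring
        rw [Finset.sum_congr rfl this, Finset.sum_sub_distrib, hd (fun i => B (w i) (w i)),
          ← Finset.mul_sum]
        field_simp; rw [← ho]
      have hb : |∑ p ∈ T.offDiag, B (w p.1 - w p.2) (w p.1 - w p.2)| ≤
          δ * (2 * (T.card - 1) * ∑ i ∈ T, n i) := by
        rw [← hd n, Finset.mul_sum]
        refine (Finset.abs_sum_le_sum_abs _ _).trans (Finset.sum_le_sum fun p hp => ?_)
        rw [Finset.mem_offDiag] at hp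
        exact h2 _ hp.1 _ hp.2.1 hp.2.2
      rw [hs, abs_mul, abs_of_pos (by positivity : 0 < 2 * ((T.card : ℝ) - 1))] at hb
      have h3 : (0 : ℝ) < 2 * (T.card - 1) := by positivity
      refine le_of_mul_le_mul_left ?_ h3
      linarith
    · rw [hsum a ha, hQ]; field_simp; ring
  · have hc : T.card = 1 := le_antisymm h hT
    refine ⟨q, ?_, fun a ha => ?_⟩
    · rw [Finset.mul_sum]
      exact (Finset.abs_sum_le_sum_abs _ _).trans (Finset.sum_le_sum fun i hi => h1 i hi)
    · have ho0 : o = 0 := by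
        obtain ⟨i, hi⟩ := Finset.card_eq_one.1 hc
        simp [ho, hi]
      rw [hsum a ha, hQ, ho0, hc]; push_cast; ring

/-! ### Bilinear forms bounded on sparse vectors. -/

section Restriction
variable {ι : Type*} [DecidableEq ι]

/-- The vector that agrees with `c` on `S` and vanishes off `S`. -/
def restr (S : Finset ι) (c : ι → ℝ) : ι → ℝ := fun i => if i ∈ S then c i else 0

theorem restr_eq_sum (S : Finset ι) (c : ι → ℝ) :
    restr S c = ∑ i ∈ S, Pi.single i (c i) := by
  funext j
  simp [restr, Finset.sum_apply, Pi.single_apply]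

theorem bilin_restr_eq_sum (S : Finset ι) (c : ι → ℝ)
    (B : (ι → ℝ) →ₗ[ℝ] (ι → ℝ) →ₗ[ℝ] ℝ) (v : ι → ℝ) :
    B (restr S c) v = ∑ i ∈ S, B (Pi.single i (c i)) v := by
  rw [restr_eq_sum, map_sum, LinearMap.sum_apply]

variable [Fintype ι]

theorem restr_add_restr_compl (S : Finset ι) (c : ι → ℝ) : restr S c + restr Sᶜ c = c := by
  funext i
  by_cases h : i ∈ S <;> simp [restr, h]

theorem sum_restr_sq (S : Finset ι) (c : ι → ℝ) :
    ∑ i, restr S c i ^ 2 = ∑ i ∈ S, c i ^ 2 := by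
  simp [restr, Finset.sum_ite_mem, ite_pow]

theorem hammingNorm_restr_le (S : Finset ι) (c : ι → ℝ) : hammingNorm (restr S c) ≤ S.card := by
  refine Finset.card_le_card fun i hi => ?_
  by_contra h
  simp [restr, h] at hi

/-- The quadratic form at a sparse vector plus a multiple of a disjointly supported one. -/
theorem abs_bilin_restr_add_le (B : (ι → ℝ) →ₗ[ℝ] (ι → ℝ) →ₗ[ℝ] ℝ) {m b : ℕ} {δ : ℝ}
    (hQ : ∀ x : ι → ℝ, hammingNorm x ≤ m → |B x x| ≤ δ * ∑ i, x i ^ 2)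
    (c : ι → ℝ) (S : Finset ι) (hm : S.card + b ≤ m) (u : ι → ℝ) (hu : hammingNorm u ≤ b)
    (huS : ∀ i ∈ S, u i = 0) (y : ℝ) :
    |B (restr S c + y • u) (restr S c + y • u)| ≤
      δ * (∑ i ∈ S, c i ^ 2 + y ^ 2 * ∑ i, u i ^ 2) := by
  refine (hQ _ ?_).trans (le_of_eq ?_)
  · have : hammingNorm (restr S c + y • u) ≤ S.card + hammingNorm u := by
      refine le_trans (Finset.card_le_card (t := S ∪ Finset.univ.filter fun i => u i ≠ 0)
        fun i hi => ?_) (Finset.card_union_le _ _)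
      by_contra h
      simp only [Finset.mem_union, Finset.mem_filter, Finset.mem_univ, true_and, not_or,
        not_not] at h
      exact (Finset.mem_filter.1 hi).2 (by simp [restr, h.1, h.2])
    omega
  · congr 1
    rw [← sum_restr_sq S c, Finset.mul_sum, ← Finset.sum_add_distrib]
    refine Finset.sum_congr rfl fun i _ => ?_
    by_cases h : i ∈ S
    · simp [huS i h]
    · simp [restr, h]; ring

/-- The basic inequality at one subset `S` of `T`: the terms quadratic in the sparse vectors that
represent `restr Tᶜ c` cancel. -/
theorem bilin_restr_pair_le (B : (ι → ℝ) →ₗ[ℝ] (ι → ℝ) →ₗ[ℝ] ℝ) (hB : ∀ x y, B x y = B y x)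
    {m k b : ℕ} {δ α β τ : ℝ} (hδ : 0 ≤ δ)
    (hQ : ∀ x : ι → ℝ, hammingNorm x ≤ m → |B x x| ≤ δ * ∑ i, x i ^ 2)
    (c : ι → ℝ) (S T : Finset ι) (hST : S ⊆ T) (hb : 1 ≤ b) (hbk : b ≤ k) (hm : S.card + b ≤ m)
    (hτ : 0 < τ) (hβ : 0 < β) (hβb : β * k ≤ b) (hα0 : 0 ≤ α) (hα : ∀ i ∉ T, |c i| ≤ α)
    (hs : ∑ i ∈ Tᶜ, |c i| ≤ k * α) :
    (1 / τ ^ 2 - 1 / β ^ 2) * B (restr S c) (restr S c) -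
        2 * (1 / τ + 1 / β) * B (restr S c) (restr Tᶜ c) ≤
      δ * ((1 / τ ^ 2 + 1 / β ^ 2) * ∑ i ∈ S, c i ^ 2 + 2 * (k * α ^ 2 / β)) := by
  set x := restr S c with hx
  set R := δ * ((1 / τ ^ 2 + 1 / β ^ 2) * ∑ i ∈ S, c i ^ 2 + 2 * (k * α ^ 2 / β)) with hR
  let C : Set (ι → ℝ) := {u | (1 / τ ^ 2 - 1 / β ^ 2) * B x x - 2 * (1 / τ + 1 / β) * B x u ≤ R}
  have hb0 : (0 : ℝ) < b := by exact_mod_cast hb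
  have hbk' : (b : ℝ) ≤ k := by exact_mod_cast hbk
  have hk0 : (0 : ℝ) < k := hb0.trans_le hbk'
  have hC : Convex ℝ C := by
    intro u hu v hv p q hp hq hpq
    simp only [C, Set.mem_ofPred_eq, map_add, map_smul, smul_eq_mul] at hu hv ⊢
    have h1 := mul_le_mul_of_nonneg_left hu hp
    have h2 := mul_le_mul_of_nonneg_left hv hq
    obtain rfl : q = 1 - p := by linarith
    linarith
  have hv : ∀ i, |restr Tᶜ c i| ≤ α := by
    intro i
    by_cases h : i ∈ T
    · simpa [restr, h] using hα0
    · simpa [restr, h] using hα i h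
  refine mem_of_sparse_mem (b := b) hC (restr Tᶜ c) (r := k * α / b) (fun i => (hv i).trans ?_)
    ?_ ?_
  · rw [le_div_iff₀ hb0, mul_comm]; gcongr
  · have e : ∑ i, |restr Tᶜ c i| = ∑ i ∈ Tᶜ, |c i| := by
      rw [← Finset.sum_subset (Finset.subset_univ Tᶜ)]
      · exact Finset.sum_congr rfl fun i hi => by
          rw [Finset.mem_compl] at hi; simp [restr, hi]
      · intro i _ hi; simp at hi; simp [restr, hi]
    rw [e]; refine hs.trans (le_of_eq ?_); field_simp
  · intro u hu0 hub hur
    have huS : ∀ i ∈ S, u i = 0 := fun i hi => hu0 i (by simp [restr, hST hi])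
    -- At most `b` entries of size at most kα/b give ‖u‖² ≤ (kα)²/b, and βk ≤ b.
    have hu2 : ∑ i, u i ^ 2 ≤ k * α ^ 2 / β := by
      have h1 : ∑ i, u i ^ 2 ≤ b * (k * α / b) ^ 2 := by
        have : ∑ i, u i ^ 2 = ∑ i with u i ≠ 0, u i ^ 2 := by
          rw [Finset.sum_filter]
          exact Finset.sum_congr rfl fun i _ => by by_cases h : u i = 0 <;> simp [h]
        rw [this]
        refine (Finset.sum_le_card_nsmul _ _ ((k * α / b) ^ 2) fun i _ => ?_).trans ?_
        · exact sq_le_sq' (by linarith [neg_abs_le (u i), hur i]) (le_of_abs_le (hur i))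
        · rw [nsmul_eq_mul]
          gcongr
          exact hub
      refine h1.trans ?_
      rw [le_div_iff₀ hβ]
      have : (b : ℝ) * (k * α / b) ^ 2 * β = k * α ^ 2 * (β * k / b) := by field_simp
      rw [this]
      exact mul_le_of_le_one_right (by positivity) ((div_le_one hb0).2 hβb)
    -- Divided by τ² and β² respectively, the upper bound at −τ and the lower bound at β contain `B
    -- u u` with coefficient 1, so it drops out of the difference.
    have h1 := le_of_abs_le (abs_bilin_restr_add_le B hQ c S hm u hub huS (-τ))
    have h2 := neg_le_of_abs_le (abs_bilin_restr_add_le B hQ c S hm u hub huS β)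
    have e : ∀ y : ℝ, B (x + y • u) (x + y • u) = B x x + 2 * y * B x u + y ^ 2 * B u u := by
      intro y
      simp only [map_add, map_smul, LinearMap.add_apply, LinearMap.smul_apply, smul_eq_mul,
        hB u x]
      ring
    rw [← hx, e] at h1 h2
    have h1' := mul_le_mul_of_nonneg_left h1 (by positivity : 0 ≤ 1 / τ ^ 2)
    have h2' := mul_le_mul_of_nonneg_left h2 (by positivity : 0 ≤ 1 / β ^ 2)
    have h3 := mul_le_mul_of_nonneg_left hu2 hδ
    simp only [C, Set.mem_ofPred_eq, hR]
    have e1 : 1 / τ ^ 2 * (B x x + 2 * -τ * B x u + (-τ) ^ 2 * B u u) =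
      1 / τ ^ 2 * B x x - 2 * (1 / τ) * B x u + B u u := by field_simp; ring
    have e2 : 1 / β ^ 2 * -(δ * (∑ i ∈ S, c i ^ 2 + β ^ 2 * ∑ i, u i ^ 2)) =
      -(δ * (1 / β ^ 2 * ∑ i ∈ S, c i ^ 2 + ∑ i, u i ^ 2)) := by field_simp
    have e3 : 1 / β ^ 2 * (B x x + 2 * β * B x u + β ^ 2 * B u u) =
      1 / β ^ 2 * B x x + 2 * (1 / β) * B x u + B u u := by field_simp
    have e4 : 1 / τ ^ 2 * (δ * (∑ i ∈ S, c i ^ 2 + (-τ) ^ 2 * ∑ i, u i ^ 2)) =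
      δ * (1 / τ ^ 2 * ∑ i ∈ S, c i ^ 2 + ∑ i, u i ^ 2) := by field_simp
    rw [e1, e4] at h1'
    rw [e2, e3] at h2'
    linarith

/-- The inequalities for the subsets of `T`, averaged over all subsets of equal size. -/
theorem exists_averaged_bounds (B : (ι → ℝ) →ₗ[ℝ] (ι → ℝ) →ₗ[ℝ] ℝ) (hB : ∀ x y, B x y = B y x)
    {m k : ℕ} {δ α : ℝ} (hδ : 0 ≤ δ) (hm2 : 2 ≤ m)
    (hQ : ∀ x : ι → ℝ, hammingNorm x ≤ m → |B x x| ≤ δ * ∑ i, x i ^ 2)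
    (c : ι → ℝ) (T : Finset ι) (hT : T.card = k) (hk : 1 ≤ k) (hα0 : 0 ≤ α)
    (hα : ∀ i ∉ T, |c i| ≤ α) (hs : ∑ i ∈ Tᶜ, |c i| ≤ k * α) :
    ∃ p : ℝ, |p| ≤ δ * ∑ i ∈ T, c i ^ 2 ∧
      (∀ a : ℕ, 1 ≤ a → a ≤ k → a ≤ m →
        |a / k * ((1 - a / k) * p + a / k * B (restr T c) (restr T c))| ≤
          δ * (a / k * ∑ i ∈ T, c i ^ 2)) ∧
      (∀ (a b : ℕ) (τ β : ℝ), 1 ≤ a → a ≤ k → 1 ≤ b → b ≤ k → a + b ≤ m → τ = a / k → 0 < β →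
        β * k ≤ b →
        (1 / τ ^ 2 - 1 / β ^ 2) * (τ * ((1 - τ) * p + τ * B (restr T c) (restr T c))) -
          2 * (1 / τ + 1 / β) * (τ * B (restr T c) (restr Tᶜ c)) ≤
        δ * ((1 / τ ^ 2 + 1 / β ^ 2) * (τ * ∑ i ∈ T, c i ^ 2) + 2 * (k * α ^ 2 / β))) := by
  have hk0 : (0 : ℝ) < k := by exact_mod_cast hk
  have hsing : ∀ i, ∑ j, (Pi.single i (c i) : ι → ℝ) j ^ 2 = c i ^ 2 := by
    intro i
    rw [Finset.sum_eq_single i] <;> simp +contextual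
  have ham1 : ∀ i, hammingNorm (Pi.single i (c i) : ι → ℝ) ≤ 1 := by
    intro i
    refine le_trans (Finset.card_le_card (t := {i}) fun j hj => ?_) (by simp)
    by_contra h
    simp only [Finset.mem_singleton] at h
    exact (Finset.mem_filter.1 hj).2 (by simp [h])
  obtain ⟨p, hp, hav⟩ := exists_average_bilin B hB (fun i => (Pi.single i (c i) : ι → ℝ)) T
    (by omega) (n := fun i => c i ^ 2) (δ := δ)
    (fun i _ => by
      have := hQ (Pi.single i (c i)) ((ham1 i).trans (by omega))
      rwa [hsing] at this)
    (fun i _ j _ hij => by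
      have := hQ (Pi.single i (c i) - Pi.single j (c j)) ?_
      · have e : ∑ l, ((Pi.single i (c i) - Pi.single j (c j) : ι → ℝ) l) ^ 2 =
            c i ^ 2 + c j ^ 2 := by
          rw [← hsing i, ← hsing j, ← Finset.sum_add_distrib]
          refine Finset.sum_congr rfl fun l _ => ?_
          simp only [Pi.sub_apply, Pi.single_apply]
          by_cases h : l = i
          · have : l ≠ j := h ▸ hij
            simp [h, hij]
          · simp [h]
        rwa [e] at this
      · refine le_trans (Finset.card_le_card (t := {i, j}) fun l hl => ?_)
          (Finset.card_le_two.trans hm2)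
        by_contra h
        simp only [Finset.mem_insert, Finset.mem_singleton, not_or] at h
        exact (Finset.mem_filter.1 hl).2 (by simp [h.1, h.2]))
  simp only [← restr_eq_sum, hT] at hav
  have lin : ∀ (a : ℕ) (f : ι → ℝ), 1 ≤ a →
      ∑ S ∈ T.powersetCard a, ∑ i ∈ S, f i = k.choose a * (a / k * ∑ i ∈ T, f i) := by
    intro a f ha
    have := sum_powersetCard_sum T ha f
    rw [hT] at this
    field_simp
    linarith
  have hch : ∀ a : ℕ, a ≤ k → (0 : ℝ) < k.choose a := fun a h => by
    exact_mod_cast Nat.choose_pos h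
  refine ⟨p, hp, fun a ha hak ham => ?_, fun a b τ β ha hak hb hbk hab hτ hβ hβb => ?_⟩
  · have h1 : |∑ S ∈ T.powersetCard a, B (restr S c) (restr S c)| ≤
        ∑ S ∈ T.powersetCard a, ∑ i ∈ S, δ * c i ^ 2 := by
      refine (Finset.abs_sum_le_sum_abs _ _).trans (Finset.sum_le_sum fun S hS => ?_)
      have := hQ (restr S c) ((hammingNorm_restr_le S c).trans
        ((Finset.mem_powersetCard.1 hS).2.trans_le ham))
      rwa [sum_restr_sq, Finset.mul_sum] at this
    rw [hav a ha, lin a _ ha, abs_mul, abs_of_pos (hch a hak), ← Finset.mul_sum] at h1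
    have := le_of_mul_le_mul_left h1 (hch a hak)
    linarith
  · have hτ0 : 0 < τ := by rw [hτ]; have : (0 : ℝ) < a := by exact_mod_cast ha
                           positivity
    have h1 := Finset.sum_le_sum (s := T.powersetCard a) fun S hS =>
      bilin_restr_pair_le B hB hδ hQ c S T (Finset.mem_powersetCard.1 hS).1 hb hbk
        (by rw [(Finset.mem_powersetCard.1 hS).2]; exact hab) hτ0 hβ hβb hα0 hα hs
    simp only [bilin_restr_eq_sum _ c B (restr Tᶜ c)] at h1 ⊢
    rw [Finset.sum_sub_distrib, ← Finset.mul_sum, ← Finset.mul_sum, hav a ha, lin a _ ha,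
      ← Finset.mul_sum, Finset.sum_add_distrib, ← Finset.mul_sum, lin a _ ha, Finset.sum_const,
      Finset.card_powersetCard, hT, nsmul_eq_mul, ← hτ] at h1
    refine le_of_mul_le_mul_left ?_ (hch a hak)
    linarith

/-- The averaged inequality for subsets of relative size `τ` and `β` real with `ρ = τ / β ≥ 1`. -/
theorem neg_bilin_le_of_ratio {p δ τ β X P Q Bv : ℝ} (hp : |p| ≤ δ * X)
    (hτ0 : 0 < τ) (hτ1 : τ ≤ 1) (hβ : 0 < β) (hρ : β ≤ τ)
    (h : (1 / τ ^ 2 - 1 / β ^ 2) * (τ * ((1 - τ) * p + τ * Q)) -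
          2 * (1 / τ + 1 / β) * (τ * Bv) ≤
        δ * ((1 / τ ^ 2 + 1 / β ^ 2) * (τ * X) + 2 * (P / β))) :
    -Bv - (τ / β - 1) / 2 * Q ≤
      δ * ((τ / β / (τ + β) - (τ / β - 1) / 2) * X + P / (τ + β)) := by
  have ht : 0 < τ + β := by positivity
  -- This factor gives `Bv` the coefficient −1. The coefficient of `p` is then −K with K ≥ 0 because
  -- β ≤ τ ≤ 1, and the term −KδX on the right absorbs it.
  have h1 := mul_le_mul_of_nonneg_left h (by positivity : 0 ≤ β / (2 * (τ + β)))
  have e1 : β / (2 * (τ + β)) * ((1 / τ ^ 2 - 1 / β ^ 2) * (τ * ((1 - τ) * p + τ * Q)) -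
      2 * (1 / τ + 1 / β) * (τ * Bv)) =
      -Bv - (τ / β - 1) / 2 * Q - (τ / β - 1) * (1 - τ) / (2 * τ) * p := by
    field_simp; ring
  have e2 : β / (2 * (τ + β)) * (δ * ((1 / τ ^ 2 + 1 / β ^ 2) * (τ * X) + 2 * (P / β))) =
      δ * ((τ / β / (τ + β) - (τ / β - 1) / 2) * X + P / (τ + β)) -
        (τ / β - 1) * (1 - τ) / (2 * τ) * (δ * X) := by
    field_simp; ring
  rw [e1, e2] at h1
  have hK : 0 ≤ (τ / β - 1) * (1 - τ) / (2 * τ) := by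
    have : 0 ≤ τ / β - 1 := by rw [sub_nonneg, le_div_iff₀ hβ]; linarith
    have : 0 ≤ 1 - τ := by linarith
    positivity
  have := mul_le_mul_of_nonneg_left (le_of_abs_le hp) hK
  linarith

/-- Bound of the quadratic form on the vectors with at most `k` nonzero entries. -/
theorem abs_bilin_restr_le (B : (ι → ℝ) →ₗ[ℝ] (ι → ℝ) →ₗ[ℝ] ℝ) (hB : ∀ x y, B x y = B y x)
    {m k : ℕ} {δ t : ℝ} (hδ : 0 ≤ δ) (hm2 : 2 ≤ m) (ht : 0 < t) (htm : t * k ≤ m)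
    (hQ : ∀ x : ι → ℝ, hammingNorm x ≤ m → |B x x| ≤ δ * ∑ i, x i ^ 2)
    (c : ι → ℝ) (T : Finset ι) (hT : T.card = k) (hk : 1 ≤ k) :
    |B (restr T c) (restr T c)| ≤ δ * (max 1 (2 / t - 1) * ∑ i ∈ T, c i ^ 2) := by
  have hX : 0 ≤ ∑ i ∈ T, c i ^ 2 := Finset.sum_nonneg fun i _ => sq_nonneg (c i)
  have hk0 : (0 : ℝ) < k := by exact_mod_cast hk
  rcases le_total k m with h | h
  · have := hQ (restr T c) ((hammingNorm_restr_le T c).trans (by omega))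
    rw [sum_restr_sq] at this
    refine this.trans ?_
    gcongr
    exact le_mul_of_one_le_left hX (le_max_left _ _)
  -- Only the bound that does not involve α is needed, so the crude α = ‖c‖₁ will do.
  · have hs : ∑ i ∈ Tᶜ, |c i| ≤ k * ∑ i, |c i| := by
      refine (Finset.sum_le_sum_of_subset_of_nonneg (Finset.subset_univ _)
        fun i _ _ => abs_nonneg _).trans (le_mul_of_one_le_left
          (Finset.sum_nonneg fun i _ => abs_nonneg _) (by exact_mod_cast hk))
    obtain ⟨p, hp, h1, -⟩ := exists_averaged_bounds B hB hδ hm2 hQ c T hT hk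
      (Finset.sum_nonneg fun i _ => abs_nonneg _)
      (fun i _ => Finset.single_le_sum (f := fun i => |c i|) (fun i _ => abs_nonneg _)
        (Finset.mem_univ i)) hs
    have := h1 m (by omega) h le_rfl
    set τ : ℝ := m / k with hτ
    set X := ∑ i ∈ T, c i ^ 2
    set Q := B (restr T c) (restr T c)
    have hτ0 : 0 < τ := by
      have : (0 : ℝ) < m := by exact_mod_cast (by omega : 0 < m)
      positivity
    have hτ1 : τ ≤ 1 := by rw [hτ, div_le_one hk0]; exact_mod_cast h
    have htτ : t ≤ τ := by rw [hτ, le_div_iff₀ hk0]; exact htm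
    rw [abs_mul, abs_of_pos hτ0] at this
    have h2 : |(1 - τ) * p + τ * Q| ≤ δ * X := le_of_mul_le_mul_left (by linarith) hτ0
    have h3 : |τ * Q| ≤ δ * X + (1 - τ) * (δ * X) := by
      have e : τ * Q = ((1 - τ) * p + τ * Q) - (1 - τ) * p := by ring
      rw [e]
      refine (abs_sub _ _).trans (add_le_add h2 ?_)
      rw [abs_mul, abs_of_nonneg (by linarith : 0 ≤ 1 - τ)]
      exact mul_le_mul_of_nonneg_left hp (by linarith)
    rw [abs_mul, abs_of_pos hτ0] at h3
    have h4 : |Q| ≤ δ * ((2 / τ - 1) * X) := by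
      refine le_of_mul_le_mul_left (h3.trans (le_of_eq ?_)) hτ0
      field_simp; ring
    refine h4.trans ?_
    have : 2 / τ - 1 ≤ max 1 (2 / t - 1) := by
      refine le_trans ?_ (le_max_right _ _)
      gcongr
    gcongr

/-- The main inequality: with `x = restr T c`, `‖x‖₂² = ∑ i ∈ T, c i ^ 2`, the number `-B(x, c)` is
bounded as soon as the form is bounded on sparse vectors. -/
theorem neg_bilin_restr_le (B : (ι → ℝ) →ₗ[ℝ] (ι → ℝ) →ₗ[ℝ] ℝ) (hB : ∀ x y, B x y = B y x)
    {m k : ℕ} {δ α t : ℝ} (hδ : 0 ≤ δ) (hm2 : 2 ≤ m) (ht : 0 < t) (ht43 : t ≤ 4 / 3)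
    (htm : t * k ≤ m)
    (hQ : ∀ x : ι → ℝ, hammingNorm x ≤ m → |B x x| ≤ δ * ∑ i, x i ^ 2)
    (c : ι → ℝ) (T : Finset ι) (hT : T.card = k) (hk : 1 ≤ k) (hα0 : 0 ≤ α)
    (hα : ∀ i ∉ T, |c i| ≤ α) (hs : ∑ i ∈ Tᶜ, |c i| ≤ k * α) :
    -B (restr T c) c ≤ δ * ((3 / t - 1) * ∑ i ∈ T, c i ^ 2 + k * α ^ 2 / t) := by
  obtain ⟨p, hp, h1, h2⟩ := exists_averaged_bounds B hB hδ hm2 hQ c T hT hk hα0 hα hs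
  have hX : 0 ≤ ∑ i ∈ T, c i ^ 2 := Finset.sum_nonneg fun i _ => sq_nonneg (c i)
  have hk0 : (0 : ℝ) < k := by exact_mod_cast hk
  set X := ∑ i ∈ T, c i ^ 2
  set P := (k : ℝ) * α ^ 2 with hP
  set Q := B (restr T c) (restr T c)
  set V := B (restr T c) (restr Tᶜ c)
  have hsplit : B (restr T c) c = Q + V := by
    conv_lhs => rw [← restr_add_restr_compl T c]
    rw [map_add, restr_add_restr_compl]
  have hP0 : 0 ≤ P := by positivity
  rw [hsplit]
  -- The bound decreases in `r`. It is what `neg_bilin_le_of_ratio` gives for τ/β = 3 and τ + β = r.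
  suffices H : ∃ r, t ≤ r ∧ -V - Q ≤ δ * ((3 / r - 1) * X + P / r) by
    obtain ⟨r, hr, h⟩ := H
    have : δ * ((3 / r - 1) * X + P / r) ≤ δ * ((3 / t - 1) * X + P / t) := by gcongr
    linarith
  have pair : ∀ (a b : ℕ) (β : ℝ), a ≤ k → 1 ≤ b → b ≤ k → a + b ≤ m → 0 < β → β * k ≤ b →
      β * k ≤ a →
      -V - ((a / k : ℝ) / β - 1) / 2 * Q ≤ δ * (((a / k : ℝ) / β / ((a / k : ℝ) + β) -
        ((a / k : ℝ) / β - 1) / 2) * X + P / ((a / k : ℝ) + β)) := by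
    intro a b β hak hb hbk hab hβ hβb hβa
    have ha0 : (0 : ℝ) < a := lt_of_lt_of_le (by positivity) hβa
    refine neg_bilin_le_of_ratio hp (by positivity)
      ((div_le_one hk0).2 (by exact_mod_cast hak)) hβ ((le_div_iff₀ hk0).2 hβa)
      (h2 a b _ β (by exact_mod_cast ha0) hak hb hbk hab rfl hβ hβb)
  -- a pair of nearly equal sizes
  have half : m ≤ 2 * k → ∃ ρ : ℝ, 1 ≤ ρ ∧ ρ ≤ 2 ∧ -V - (ρ - 1) / 2 * Q ≤
      δ * ((ρ / (m / k) - (ρ - 1) / 2) * X + P / (m / k)) := by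
    intro hmk
    obtain ⟨a, b, hab, hb1, hba, ha2⟩ : ∃ a b, a + b = m ∧ 1 ≤ b ∧ b ≤ a ∧ a ≤ 2 * b ∧ a ≤ k :=
      ⟨(m + 1) / 2, m / 2, by omega, by omega, by omega, by omega, by omega⟩
    have hb0 : (0 : ℝ) < b := by exact_mod_cast hb1
    have e : (b / k : ℝ) * k = b := by field_simp
    have := pair a b (b / k) ha2.2 hb1 (by omega) hab.le (by positivity) e.le
      (by rw [e]; exact_mod_cast hba)
    have e1 : (a / k : ℝ) / (b / k) = a / b := by field_simp
    have e2 : (a / k : ℝ) + b / k = m / k := by rw [← hab]; push_cast; ring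
    rw [e1, e2] at this
    refine ⟨a / b, ?_, ?_, this⟩
    · rw [le_div_iff₀ hb0, one_mul]; exact_mod_cast hba
    · rw [div_le_iff₀ hb0]; exact_mod_cast ha2.1
  have hm0 : (0 : ℝ) < m := by exact_mod_cast (by omega : 0 < m)
  have htmk : t ≤ m / k := by rw [le_div_iff₀ hk0]; exact htm
  rcases le_total m k with hmk | hmk
  -- For m ≤ k, ratio 3 is reached from ρ ≤ 2 by adding (3−ρ)/2 times a lower bound for `Q`,
  -- obtained by averaging over the `m`-subsets of `T`.
  · refine ⟨m / k, htmk, ?_⟩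
    obtain ⟨ρ, hρ1, hρ2, hρ⟩ := half (by omega)
    have hτ1 : (m / k : ℝ) ≤ 1 := (div_le_one hk0).2 (by exact_mod_cast hmk)
    have h3 := h1 m (by omega) hmk le_rfl
    set τ : ℝ := m / k with hτ
    have hτ0 : 0 < τ := by positivity
    rw [abs_mul, abs_of_pos hτ0] at h3
    have h4 : |(1 - τ) * p + τ * Q| ≤ δ * X := le_of_mul_le_mul_left (by linarith) hτ0
    have h5 : -(δ * ((2 / τ - 1) * X)) ≤ Q := by
      have h6 := neg_le_of_abs_le h4
      have h7 := mul_le_mul_of_nonneg_left (le_of_abs_le hp) (by linarith : 0 ≤ 1 - τ)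
      refine le_of_mul_le_mul_left ?_ hτ0
      have e : τ * -(δ * ((2 / τ - 1) * X)) = -(δ * X) - (1 - τ) * (δ * X) := by
        field_simp; ring
      rw [e]; linarith
    have h6 := mul_le_mul_of_nonneg_left h5 (by linarith : 0 ≤ (3 - ρ) / 2)
    have e : δ * ((3 / τ - 1) * X + P / τ) =
        δ * ((ρ / τ - (ρ - 1) / 2) * X + P / τ) - (3 - ρ) / 2 * -(δ * ((2 / τ - 1) * X)) := by
      field_simp; ring
    rw [e]; linarith
  rcases le_or_gt (3 * m) (4 * k) with hm43 | hm43
  -- For k < m ≤ 4k/3 the pair of sizes (k, m−k) has ratio ρ' ≥ 3. At the common value τ + β = m/k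
  -- both sides are affine in the ratio, so ρ ≤ 2 and ρ' interpolate to 3. For m = k the form is
  -- bounded at `restr T c` itself.
  · refine ⟨m / k, htmk, ?_⟩
    obtain ⟨ρ, hρ1, hρ2, hρ⟩ := half (by omega)
    rcases hmk.eq_or_lt with heq | hlt
    · have h3 := h1 m (by omega) (by omega) le_rfl
      have e1 : (m / k : ℝ) = 1 := by rw [heq]; exact div_self hm0.ne'
      rw [e1] at h3 hρ ⊢
      have h5 := neg_le_of_abs_le h3
      simp only [sub_self, zero_mul, zero_add, one_mul] at h5
      have h6 := mul_le_mul_of_nonneg_left h5 (by linarith : 0 ≤ (3 - ρ) / 2)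
      linarith
    · have e : (((m - k : ℕ) : ℝ) / k) * k = (m - k : ℕ) := by field_simp
      have hd0 : (0 : ℝ) < (m - k : ℕ) := by exact_mod_cast (by omega : 0 < m - k)
      have := pair k (m - k) ((m - k : ℕ) / k) le_rfl (by omega) (by omega) (by omega)
        (by positivity) e.le (by rw [e]; exact_mod_cast (by omega))
      have e1 : (k / k : ℝ) / ((m - k : ℕ) / k) = k / (m - k : ℕ) := by field_simp
      have e2 : (k / k : ℝ) + (m - k : ℕ) / k = m / k := by
        rw [Nat.cast_sub hmk]; field_simp; ring
      rw [e1, e2] at this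
      have h3 : (3 : ℝ) ≤ k / (m - k : ℕ) := by
        rw [le_div_iff₀ hd0]; exact_mod_cast (by omega)
      set ρ' : ℝ := k / (m - k : ℕ)
      have g1 := mul_le_mul_of_nonneg_left hρ (by linarith : 0 ≤ ρ' - 3)
      have g2 := mul_le_mul_of_nonneg_left this (by linarith : 0 ≤ 3 - ρ)
      have g3 : 0 < ρ' - ρ := by linarith
      refine le_of_mul_le_mul_left ?_ g3
      set τ : ℝ := m / k with hτ
      have hτ0 : 0 < τ := by positivity
      calc (ρ' - ρ) * (-V - Q) = (ρ' - 3) * (-V - (ρ - 1) / 2 * Q) +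
            (3 - ρ) * (-V - (ρ' - 1) / 2 * Q) := by ring
        _ ≤ _ := add_le_add g1 g2
        _ = _ := by field_simp; ring
  -- For m > 4k/3 ratio 3 is available directly: S = T, β = 1/3, with `(k + 2) / 3` = ⌈k/3⌉ as the
  -- size `b`.
  · refine ⟨4 / 3, ht43, ?_⟩
    have := pair k ((k + 2) / 3) (1 / 3) le_rfl (by omega) (by omega) (by omega) (by norm_num)
      (by have : k ≤ 3 * ((k + 2) / 3) := by omega
          have : (k : ℝ) ≤ 3 * ((k + 2) / 3 : ℕ) := by exact_mod_cast this
          linarith) (by linarith)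
    rw [div_self hk0.ne'] at this
    norm_num at this ⊢
    linarith

end Restriction

/-! ### Norms in coordinates. -/

section Norms
variable {n : ℕ}

theorem lpNorm_two_nonneg (v : Fin n → ℝ) : 0 ≤ lpNorm 2 v := norm_nonneg _

theorem lpNorm_two_sq (v : Fin n → ℝ) : lpNorm 2 v ^ 2 = v ⬝ᵥ v := by
  rw [lpNorm, EuclideanSpace.norm_sq_eq]
  simp [dotProduct, sq]

theorem lpNorm_two (v : Fin n → ℝ) : lpNorm 2 v = √(v ⬝ᵥ v) := by
  rw [← lpNorm_two_sq, Real.sqrt_sq (lpNorm_two_nonneg v)]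

theorem lpNorm_one (v : Fin n → ℝ) : lpNorm 1 v = ∑ i, |v i| := by
  rw [lpNorm, PiLp.norm_eq_of_L1]; simp

theorem abs_le_lpNorm_top (v : Fin n → ℝ) (i : Fin n) : |v i| ≤ lpNorm ∞ v := by
  have := PiLp.norm_apply_le (WithLp.toLp ∞ v) i
  simpa [lpNorm] using this

theorem lpNorm_top_le (v : Fin n → ℝ) {r : ℝ} (hr : 0 ≤ r) (h : ∀ i, |v i| ≤ r) :
    lpNorm ∞ v ≤ r := by
  rw [lpNorm, PiLp.norm_toLp]
  exact (pi_norm_le_iff_of_nonneg hr).2 h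

theorem dotProduct_le_lpNorm_mul (v w : Fin n → ℝ) : v ⬝ᵥ w ≤ lpNorm 2 v * lpNorm 2 w := by
  have := real_inner_le_norm (WithLp.toLp 2 w) (WithLp.toLp 2 v)
  rw [EuclideanSpace.inner_toLp_toLp] at this
  simpa [lpNorm, mul_comm] using this

theorem sum_abs_le_sqrt_mul {ι : Type*} (T : Finset ι) (c : ι → ℝ) :
    ∑ i ∈ T, |c i| ≤ √T.card * √(∑ i ∈ T, c i ^ 2) := by
  rw [← Real.sqrt_mul (Nat.cast_nonneg _)]
  refine Real.le_sqrt_of_sq_le ?_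
  have := sq_sum_le_card_mul_sum_sq (s := T) (f := fun i => |c i|)
  simpa using this

end Norms

/-! ### Tight frames and the form attached to the D-RIP. -/

section Frame
variable {M N d : ℕ} {D : Matrix (Fin N) (Fin d) ℝ}

theorem IsTightFrame.mulVec_transpose_mulVec (hD : IsTightFrame D) (f : Fin N → ℝ) :
    D *ᵥ (Dᵀ *ᵥ f) = f := by
  conv_rhs => rw [← (hD f).1]
  rw [Matrix.mulVec_eq_sum]
  funext j
  simp [Finset.sum_apply, Matrix.mulVec, dotProduct, Matrix.col, mul_comm]

theorem dotProduct_transpose_mulVec {m n : Type*} [Fintype m] [Fintype n] (A : Matrix m n ℝ)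
    (x : n → ℝ) (y : m → ℝ) : x ⬝ᵥ (Aᵀ *ᵥ y) = (A *ᵥ x) ⬝ᵥ y := by
  rw [Matrix.dotProduct_mulVec, Matrix.vecMul_transpose]

/-- `Dᵀ * D` is an orthogonal projection, here in the form ‖x − DᵀDx‖² ≥ 0. -/
theorem IsTightFrame.dotProduct_mulVec_le (hD : IsTightFrame D) (x : Fin d → ℝ) :
    (D *ᵥ x) ⬝ᵥ (D *ᵥ x) ≤ ∑ i, x i ^ 2 := by
  set y := Dᵀ *ᵥ (D *ᵥ x) with hy
  have h1 : x ⬝ᵥ y = (D *ᵥ x) ⬝ᵥ (D *ᵥ x) := dotProduct_transpose_mulVec D x _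
  have h2 : y ⬝ᵥ y = (D *ᵥ x) ⬝ᵥ (D *ᵥ x) := by
    conv_lhs => rw [hy, dotProduct_transpose_mulVec, ← hy, hD.mulVec_transpose_mulVec]
  have h3 : 0 ≤ (x - y) ⬝ᵥ (x - y) := by
    simp only [dotProduct]; exact Finset.sum_nonneg fun i _ => mul_self_nonneg _
  have h4 : (x - y) ⬝ᵥ (x - y) = x ⬝ᵥ x - 2 * (x ⬝ᵥ y) + y ⬝ᵥ y := by
    simp only [sub_dotProduct, dotProduct_sub, dotProduct_comm y x]; ring
  have h5 : x ⬝ᵥ x = ∑ i, x i ^ 2 := by simp [dotProduct, sq]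
  linarith

theorem IsTightFrame.sum_sq (hD : IsTightFrame D) (h : Fin N → ℝ) :
    ∑ i, (Dᵀ *ᵥ h) i ^ 2 = lpNorm 2 h ^ 2 := by
  have : ∑ i, (Dᵀ *ᵥ h) i ^ 2 = (Dᵀ *ᵥ h) ⬝ᵥ (Dᵀ *ᵥ h) := by simp [dotProduct, sq]
  rw [this, dotProduct_transpose_mulVec, hD.mulVec_transpose_mulVec, lpNorm_two_sq]

/-- The symmetric bilinear form `⟨Φ D x, Φ D y⟩ - ⟨D x, D y⟩`. -/
noncomputable def dripForm (Φ : Matrix (Fin M) (Fin N) ℝ) (D : Matrix (Fin N) (Fin d) ℝ) :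
    (Fin d → ℝ) →ₗ[ℝ] (Fin d → ℝ) →ₗ[ℝ] ℝ :=
  LinearMap.mk₂ ℝ (fun x y => (Φ *ᵥ (D *ᵥ x)) ⬝ᵥ (Φ *ᵥ (D *ᵥ y)) - (D *ᵥ x) ⬝ᵥ (D *ᵥ y))
    (fun x y z => by simp only [Matrix.mulVec_add, add_dotProduct]; ring)
    (fun a x y => by simp only [Matrix.mulVec_smul, smul_dotProduct, smul_eq_mul]; ring)
    (fun x y z => by simp only [Matrix.mulVec_add, dotProduct_add]; ring)
    (fun a x y => by simp only [Matrix.mulVec_smul, dotProduct_smul, smul_eq_mul]; ring)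

theorem dripForm_apply (Φ : Matrix (Fin M) (Fin N) ℝ) (D : Matrix (Fin N) (Fin d) ℝ)
    (x y : Fin d → ℝ) : dripForm Φ D x y =
      (Φ *ᵥ (D *ᵥ x)) ⬝ᵥ (Φ *ᵥ (D *ᵥ y)) - (D *ᵥ x) ⬝ᵥ (D *ᵥ y) := rfl

theorem dripForm_comm (Φ : Matrix (Fin M) (Fin N) ℝ) (D : Matrix (Fin N) (Fin d) ℝ)
    (x y : Fin d → ℝ) : dripForm Φ D x y = dripForm Φ D y x := by
  rw [dripForm_apply, dripForm_apply, dotProduct_comm, dotProduct_comm (D *ᵥ x)]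

theorem DRIP.abs_dripForm_le {Φ : Matrix (Fin M) (Fin N) ℝ} {m : ℕ} {δ : ℝ}
    (h : DRIP Φ D m δ) (hD : IsTightFrame D) (hδ0 : 0 ≤ δ) (hδ1 : δ ≤ 1)
    (x : Fin d → ℝ) (hx : hammingNorm x ≤ m) : |dripForm Φ D x x| ≤ δ * ∑ i, x i ^ 2 := by
  obtain ⟨h1, h2⟩ := h x hx
  have g1 := mul_self_le_mul_self (mul_nonneg (Real.sqrt_nonneg _) (lpNorm_two_nonneg _)) h1
  have g2 := mul_self_le_mul_self (lpNorm_two_nonneg _) h2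
  rw [← sq, ← sq, mul_pow, Real.sq_sqrt (by linarith), lpNorm_two_sq, lpNorm_two_sq] at g1 g2
  have g3 := mul_le_mul_of_nonneg_left (hD.dotProduct_mulVec_le x) hδ0
  rw [dripForm_apply, abs_le]
  constructor <;> linarith

/-- The restricted isometry constant is attained. -/
theorem dRIP_dripConst (Φ : Matrix (Fin M) (Fin N) ℝ) (D : Matrix (Fin N) (Fin d) ℝ) (k : ℕ) :
    0 ≤ dripConst Φ D k ∧ DRIP Φ D k (dripConst Φ D k) := by
  have hcl : IsClosed {δ : ℝ | 0 ≤ δ ∧ DRIP Φ D k δ} := by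
    have : {δ : ℝ | 0 ≤ δ ∧ DRIP Φ D k δ} = {δ : ℝ | 0 ≤ δ} ∩ ⋂ x : Fin d → ℝ,
        ⋂ _ : IsSparse k x, {δ : ℝ | √(1 - δ) * lpNorm 2 (D *ᵥ x) ≤ lpNorm 2 (Φ *ᵥ (D *ᵥ x))} ∩
          {δ : ℝ | lpNorm 2 (Φ *ᵥ (D *ᵥ x)) ≤ √(1 + δ) * lpNorm 2 (D *ᵥ x)} := by
      ext δ; simp [DRIP]
    rw [this]
    refine isClosed_Ici.inter (isClosed_iInter fun x => isClosed_iInter fun _ => ?_)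
    exact (isClosed_le (by fun_prop) (by fun_prop)).inter (isClosed_le (by fun_prop) (by fun_prop))
  have hne : {δ : ℝ | 0 ≤ δ ∧ DRIP Φ D k δ}.Nonempty := by
    let L := (Matrix.toEuclideanLin Φ).toContinuousLinearMap
    -- A value of at least 1 makes the lower inequality trivial, since the square root of a
    -- nonpositive number is 0.
    refine ⟨1 + ‖L‖ ^ 2, by positivity, fun x _ => ⟨?_, ?_⟩⟩
    · rw [Real.sqrt_eq_zero_of_nonpos (by nlinarith [sq_nonneg ‖L‖]), zero_mul]
      exact norm_nonneg _
    · have h1 : lpNorm 2 (Φ *ᵥ (D *ᵥ x)) ≤ ‖L‖ * lpNorm 2 (D *ᵥ x) :=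
        L.le_opNorm (WithLp.toLp 2 (D *ᵥ x))
      refine h1.trans (mul_le_mul_of_nonneg_right ?_ (norm_nonneg _))
      exact Real.le_sqrt_of_sq_le (by linarith)
  exact hcl.csInf_mem hne ⟨0, fun δ h => h.1⟩

end Frame

/-! ### The deterministic recovery estimate. -/

/-- A set of `k` indices carrying the largest part of the `ℓ₁` norm. -/
theorem exists_top_set {ι : Type*} [Fintype ι] [DecidableEq ι] (c : ι → ℝ) {k : ℕ}
    (hk : k ≤ Fintype.card ι) :
    ∃ T : Finset ι, T.card = k ∧ (∀ i ∉ T, k * |c i| ≤ ∑ j ∈ T, |c j|) ∧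
      ∀ S : Finset ι, S.card ≤ k → ∑ j ∈ S, |c j| ≤ ∑ j ∈ T, |c j| := by
  have hne : (Finset.univ.powersetCard k : Finset (Finset ι)).Nonempty :=
    Finset.powersetCard_nonempty.2 (by simpa using hk)
  obtain ⟨T, hT, hmax⟩ := Finset.exists_max_image _ (fun T => ∑ j ∈ T, |c j|) hne
  have hTc : T.card = k := (Finset.mem_powersetCard.1 hT).2
  refine ⟨T, hTc, fun i hi => ?_, fun S hS => ?_⟩
  · have : ∀ j ∈ T, |c i| ≤ |c j| := by
      intro j hj
      have hi' : i ∉ T.erase j := fun h => hi (Finset.mem_of_mem_erase h)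
      have := hmax (insert i (T.erase j)) (Finset.mem_powersetCard.2 ⟨Finset.subset_univ _, by
        rw [Finset.card_insert_of_notMem hi', Finset.card_erase_of_mem hj, hTc]
        have := Finset.card_pos.2 ⟨j, hj⟩
        omega⟩)
      rw [Finset.sum_insert hi'] at this
      have e := Finset.add_sum_erase T (fun j => |c j|) hj
      simp only at this e
      linarith
    calc k * |c i| = ∑ j ∈ T, |c i| := by rw [Finset.sum_const, hTc, nsmul_eq_mul]
      _ ≤ _ := Finset.sum_le_sum this
  · obtain ⟨S', hSS', -, hS'⟩ := Finset.exists_subsuperset_card_eq (Finset.subset_univ S) hS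
      (by simpa using hk)
    exact (Finset.sum_le_sum_of_subset_of_nonneg hSS' fun _ _ _ => abs_nonneg _).trans
      (hmax S' (Finset.mem_powersetCard.2 ⟨Finset.subset_univ _, hS'⟩))

/-- The quadratic inequality that bounds the head of the error. -/
theorem head_le_of_quadratic {t δ X e ν : ℝ} (hδ : 0 ≤ δ) (ht : 0 < t) (he : 0 ≤ e)
    (hν : 0 ≤ ν) (hΔ : 0 < t + (t - 4) * δ)
    (h : X ^ 2 - ν * X ≤ δ * ((3 / t - 1) * X ^ 2 + (X + e) ^ 2 / t)) :
    X ≤ (t * ν + 2 * δ * e + e * √((t + (t - 4) * δ) * δ)) / (t + (t - 4) * δ) := by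
  set Δ := t + (t - 4) * δ with hΔd
  have h1 := mul_le_mul_of_nonneg_left h ht.le
  have e1 : t * (δ * ((3 / t - 1) * X ^ 2 + (X + e) ^ 2 / t)) =
      δ * ((3 - t) * X ^ 2 + (X + e) ^ 2) := by field_simp
  rw [e1] at h1
  have h2 : Δ * X ^ 2 - (t * ν + 2 * δ * e) * X - δ * e ^ 2 ≤ 0 := by
    rw [hΔd]; linarith
  set r := √(Δ * δ) with hr
  have hr2 : r ^ 2 = Δ * δ := Real.sq_sqrt (by positivity)
  have hr0 : 0 ≤ r := Real.sqrt_nonneg _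
  set p := t * ν + 2 * δ * e with hp
  have hp0 : 0 ≤ p := by positivity
  rw [le_div_iff₀ hΔ]
  by_contra hlt
  push Not at hlt
  -- with `Y = Δ X` the inequality reads `Y (Y - p) ≤ (r e)²`
  have h3 : (X * Δ) * (X * Δ - p) ≤ (e * r) ^ 2 := by
    have := mul_le_mul_of_nonneg_left h2 hΔ.le
    rw [mul_pow, hr2]
    linarith
  have h4 : 0 ≤ e * r := by positivity
  nlinarith

section Recovery
variable {M N d s : ℕ} {Φ : Matrix (Fin M) (Fin N) ℝ} {D : Matrix (Fin N) (Fin d) ℝ}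

/-- Restriction to the first summand of the index set. -/
noncomputable def unpad (d s : ℕ) : (Fin d ⊕ Fin s → ℝ) →ₗ[ℝ] (Fin d → ℝ) :=
  LinearMap.funLeft ℝ ℝ Sum.inl

theorem unpad_apply (x : Fin d ⊕ Fin s → ℝ) (i : Fin d) : unpad d s x i = x (Sum.inl i) := rfl

theorem hammingNorm_unpad_le (x : Fin d ⊕ Fin s → ℝ) :
    hammingNorm (unpad d s x) ≤ hammingNorm x :=
  Finset.card_le_card_of_injOn Sum.inl (fun _ hi =>
    Finset.mem_filter.2 ⟨Finset.mem_univ _, (Finset.mem_filter.1 hi).2⟩) Sum.inl_injective.injOn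

theorem sum_unpad_sq_le (x : Fin d ⊕ Fin s → ℝ) : ∑ i, unpad d s x i ^ 2 ≤ ∑ i, x i ^ 2 := by
  rw [Fintype.sum_sum_type]
  exact le_add_of_nonneg_right (Finset.sum_nonneg fun i _ => sq_nonneg _)

/-- The form `dripForm` with `s` additional coordinates that it ignores. -/
noncomputable def padForm (Φ : Matrix (Fin M) (Fin N) ℝ) (D : Matrix (Fin N) (Fin d) ℝ) (s : ℕ) :
    (Fin d ⊕ Fin s → ℝ) →ₗ[ℝ] (Fin d ⊕ Fin s → ℝ) →ₗ[ℝ] ℝ :=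
  (dripForm Φ D).compl₁₂ (unpad d s) (unpad d s)

theorem padForm_apply (x y : Fin d ⊕ Fin s → ℝ) :
    padForm Φ D s x y = dripForm Φ D (unpad d s x) (unpad d s y) := rfl

theorem DRIP.abs_padForm_le {m : ℕ} {δ : ℝ} (h : DRIP Φ D m δ) (hD : IsTightFrame D)
    (hδ0 : 0 ≤ δ) (hδ1 : δ ≤ 1) (x : Fin d ⊕ Fin s → ℝ) (hx : hammingNorm x ≤ m) :
    |padForm Φ D s x x| ≤ δ * ∑ i, x i ^ 2 :=
  (h.abs_dripForm_le hD hδ0 hδ1 _ ((hammingNorm_unpad_le x).trans hx)).trans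
    (mul_le_mul_of_nonneg_left (sum_unpad_sq_le x) hδ0)

/-- Order 2 is what the averaging needs: differences of two coordinate vectors are then admissible,
and the order splits into two positive sizes. -/
theorem two_le_ceil {t : ℝ} (hts : 1 < t * s) : 2 ≤ ⌈t * s⌉₊ :=
  Nat.lt_ceil.2 (by simpa using hts)

/-- `Φ D` on the `s`-sparse vectors. -/
theorem DRIP.lpNorm_sq_le {t δ : ℝ} (hD : IsTightFrame D) (hs : 1 ≤ s) (ht0 : 0 < t)
    (hts : 1 < t * s) (hδ0 : 0 ≤ δ) (hδ1 : δ ≤ 1) (h : DRIP Φ D ⌈t * s⌉₊ δ)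
    (x : Fin d → ℝ) (hx : hammingNorm x ≤ s) :
    lpNorm 2 (Φ *ᵥ (D *ᵥ x)) ^ 2 ≤ (1 + δ) * max 1 (1 / t) * ∑ i, x i ^ 2 := by
  set x' : Fin d ⊕ Fin s → ℝ := Sum.elim x 0 with hx'
  have hham : (Finset.univ.filter fun i => x' i ≠ 0).card ≤ s := by
    refine le_trans (Finset.card_le_card (t := (Finset.univ.filter fun i => x i ≠ 0).map
      Function.Embedding.inl) fun i hi => ?_) (by rw [Finset.card_map]; exact hx)
    rcases i with i | i
    · simpa [hx'] using hi
    · simp [hx'] at hi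
  obtain ⟨T, hT, -, hTc⟩ := Finset.exists_subsuperset_card_eq
    (Finset.subset_univ (Finset.univ.filter fun i => x' i ≠ 0)) hham (by simp)
  have hr : restr T x' = x' := by
    funext i
    by_cases hi : x' i = 0
    · simp [restr, hi]
    · have := hT (by simpa using hi : i ∈ Finset.univ.filter fun i => x' i ≠ 0)
      simp [restr, this]
  have hu : unpad d s x' = x := by funext i; simp [unpad_apply, hx']
  have hsum : ∑ i ∈ T, x' i ^ 2 = ∑ i, x i ^ 2 := by
    rw [← sum_restr_sq, hr, Fintype.sum_sum_type]; simp [hx']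
  have h1 := le_of_abs_le <| abs_bilin_restr_le (padForm Φ D s)
    (fun x y => dripForm_comm Φ D _ _) hδ0 (two_le_ceil hts) ht0 (Nat.le_ceil _)
    (h.abs_padForm_le hD hδ0 hδ1) x' T hTc hs
  rw [hr, padForm_apply, hu, dripForm_apply, hsum] at h1
  have h2 := hD.dotProduct_mulVec_le x
  have hX : 0 ≤ ∑ i, x i ^ 2 := Finset.sum_nonneg fun i _ => sq_nonneg _
  rw [lpNorm_two_sq]
  -- For t ≤ 1 the two sides differ by (1−δ)(1/t−1), so δ ≤ 1 matters.
  have h3 : 1 + δ * max 1 (2 / t - 1) ≤ (1 + δ) * max 1 (1 / t) := by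
    rcases le_total 1 t with h | h
    · rw [max_eq_left, max_eq_left]
      · linarith
      · rw [div_le_one ht0]; exact h
      · have : 1 / t ≤ 1 := by rw [div_le_one ht0]; exact h
        have e : 2 / t = 2 * (1 / t) := by ring
        linarith
    · have g : 1 ≤ 1 / t := by rw [le_div_iff₀ ht0]; linarith
      have e : 2 / t = 2 * (1 / t) := by ring
      rw [max_eq_right g, max_eq_right (by linarith), e]
      nlinarith [mul_nonneg (sub_nonneg.2 g) (sub_nonneg.2 hδ1)]
  have h4 := mul_le_mul_of_nonneg_right h3 hX
  linarith

theorem sum_compl_sq_le {ι : Type*} [Fintype ι] [DecidableEq ι] {k A : ℝ} (hk : 0 < k)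
    (T : Finset ι) (c : ι → ℝ) (hmin : ∀ i ∉ T, k * |c i| ≤ A) :
    ∑ i ∈ Tᶜ, c i ^ 2 ≤ A / k * ∑ i ∈ Tᶜ, |c i| := by
  rw [Finset.mul_sum]
  refine Finset.sum_le_sum fun i hi => ?_
  rw [← sq_abs, sq]
  refine mul_le_mul_of_nonneg_right ?_ (abs_nonneg _)
  rw [le_div_iff₀ hk]
  linarith [hmin i (Finset.mem_compl.1 hi)]

/-- With e = 2q, completing the square gives 2X² + Xe ≤ 2(X + e/4)²; the summand e/4 is the source
of √2/2 in `constB`. -/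
theorem lpNorm_arith {L X q t δ ν : ℝ} (hX0 : 0 ≤ X) (he0 : 0 ≤ 2 * q)
    (hh : L ^ 2 ≤ 2 * X ^ 2 + X * (2 * q))
    (hXle : X ≤ (t * ν + 2 * δ * (2 * q) + (2 * q) * √((t + (t - 4) * δ) * δ)) /
      (t + (t - 4) * δ)) :
    L ≤ √2 * (t * ν) / (t + (t - 4) * δ) + constB t δ * q := by
  have h22 : √2 * √2 = (2 : ℝ) := Real.mul_self_sqrt (by norm_num)
  have hfin : L ≤ √2 * X + √2 / 4 * (2 * q) := by
    refine (abs_le_of_sq_le_sq' (hh.trans ?_) (by positivity)).2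
    have : (√2 * X + √2 / 4 * (2 * q)) ^ 2 = (√2 * √2) * (X + (2 * q) / 4) ^ 2 := by ring
    rw [this, h22]; nlinarith [sq_nonneg q]
  have := mul_le_mul_of_nonneg_left hXle (Real.sqrt_nonneg 2)
  rw [constB]
  set Δ := t + (t - 4) * δ
  set R := √(Δ * δ)
  calc L ≤ √2 * ((t * ν + 2 * δ * (2 * q) + (2 * q) * R) / Δ) + √2 / 4 * (2 * q) := by linarith
    _ = _ := by ring

/-- Recovery estimate for a vector `h` whose analysis coefficients satisfy the cone condition, in
terms of a bound `ν` for `⟨Φ D x, Φ h⟩` on the `s`-sparse unit vectors. -/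
theorem DRIP.lpNorm_le_of_cone {t δ η ν : ℝ} (hD : IsTightFrame D) (hs : 1 ≤ s) (ht0 : 0 < t)
    (ht : t < 4 / 3) (hts : 1 < t * s) (hδ0 : 0 ≤ δ) (hδ : δ < t / (4 - t))
    (hdrip : DRIP Φ D ⌈t * s⌉₊ δ) (h : Fin N → ℝ) (hη : 0 ≤ η) (hν : 0 ≤ ν)
    (S : Finset (Fin d)) (hS : S.card ≤ s)
    (hcone : ∑ i, |(Dᵀ *ᵥ h) i| ≤ 2 * ∑ i ∈ S, |(Dᵀ *ᵥ h) i| + 2 * η)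
    (hN : ∀ x : Fin d → ℝ, hammingNorm x ≤ s →
      (Φ *ᵥ (D *ᵥ x)) ⬝ᵥ (Φ *ᵥ h) ≤ ν * √(∑ i, x i ^ 2)) :
    lpNorm 2 h ≤ √2 * (t * ν) / (t + (t - 4) * δ) + constB t δ * (η / √s) := by
  have hΔ : 0 < t + (t - 4) * δ := by
    rw [lt_div_iff₀ (by linarith)] at hδ; linarith
  have hδ1 : δ ≤ 1 := by
    refine hδ.le.trans ?_
    rw [div_le_one (by linarith)]; linarith
  have hs0 : (0 : ℝ) < s := by exact_mod_cast hs
  have hr0 : 0 < √(s : ℝ) := Real.sqrt_pos.2 hs0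
  have hrr : √(s : ℝ) * √s = s := Real.mul_self_sqrt hs0.le
  set r := √(s : ℝ)
  set c := Dᵀ *ᵥ h with hc
  -- The `s` extra zeros guarantee an index set of exactly `s` elements even if d < s.
  set c' : Fin d ⊕ Fin s → ℝ := Sum.elim c 0 with hc'
  have hu : unpad d s c' = c := by funext i; simp [unpad_apply, hc']
  obtain ⟨T, hT, hmin, hmax⟩ := exists_top_set c' (k := s) (by simp)
  set X := √(∑ i ∈ T, c' i ^ 2) with hX
  have hX0 : 0 ≤ X := Real.sqrt_nonneg _
  have hX2 : ∑ i ∈ T, c' i ^ 2 = X ^ 2 :=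
    (Real.sq_sqrt (Finset.sum_nonneg fun i _ => sq_nonneg _)).symm
  set A := ∑ i ∈ T, |c' i| with hA
  have hA0 : 0 ≤ A := Finset.sum_nonneg fun i _ => abs_nonneg _
  have hAX : A ≤ r * X := by
    have := sum_abs_le_sqrt_mul T c'
    rwa [hT] at this
  have htail : ∑ i ∈ Tᶜ, |c' i| ≤ A + 2 * η := by
    have h1 := Finset.sum_add_sum_compl T fun i => |c' i|
    have h2 : ∑ i, |c' i| = ∑ i, |c i| := by rw [Fintype.sum_sum_type]; simp [hc']
    have h3 : ∑ i ∈ S, |c i| ≤ A := by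
      have := hmax (S.map Function.Embedding.inl) (by rwa [Finset.card_map])
      rw [Finset.sum_map] at this
      simpa [hc'] using this
    linarith
  set α := (A + 2 * η) / s with hα
  have hα0 : 0 ≤ α := by positivity
  have hsα : s * α = A + 2 * η := by rw [hα]; field_simp
  have hmain := neg_bilin_restr_le (padForm Φ D s)
    (fun x y => dripForm_comm Φ D _ _) hδ0 (two_le_ceil hts) ht0 ht.le (Nat.le_ceil _)
    (hdrip.abs_padForm_le hD hδ0 hδ1) c' T hT hs hα0
    (fun i hi => by
      rw [hα, le_div_iff₀ hs0]
      linarith [hmin i hi]) (by rw [hsα]; exact htail)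
  set x := unpad d s (restr T c') with hx
  have hxc : x ⬝ᵥ c = X ^ 2 := by
    rw [← hX2, ← sum_restr_sq, Fintype.sum_sum_type]
    simp only [dotProduct, hx, unpad_apply, restr, hc']
    simp [ite_mul, ite_pow, sq]
  have hxX : √(∑ i, x i ^ 2) ≤ X := by
    refine Real.sqrt_le_sqrt ?_
    rw [← sum_restr_sq T c']; exact sum_unpad_sq_le _
  have hNx : (Φ *ᵥ (D *ᵥ x)) ⬝ᵥ (Φ *ᵥ h) ≤ ν * X :=
    (hN x ((hammingNorm_unpad_le _).trans ((hammingNorm_restr_le T c').trans hT.le))).trans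
      (mul_le_mul_of_nonneg_left hxX hν)
  rw [padForm_apply, hu, ← hx, dripForm_apply, hc, hD.mulVec_transpose_mulVec,
    ← dotProduct_transpose_mulVec D x h, ← hc, hxc, hX2] at hmain
  set e := 2 * (η / r) with he
  have he0 : 0 ≤ e := by positivity
  have hre : r * e = 2 * η := by rw [he]; field_simp
  have hP : s * α ^ 2 ≤ (X + e) ^ 2 := by
    have h1 : r * α ≤ X + e := by
      refine le_of_mul_le_mul_left ?_ hr0
      rw [← mul_assoc, hrr, hsα, mul_add, hre]; linarith
    calc s * α ^ 2 = (r * α) ^ 2 := by rw [mul_pow, sq r, hrr]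
      _ ≤ _ := pow_le_pow_left₀ (by positivity) h1 2
  have hquad : X ^ 2 - ν * X ≤ δ * ((3 / t - 1) * X ^ 2 + (X + e) ^ 2 / t) := by
    have : δ * ((3 / t - 1) * X ^ 2 + s * α ^ 2 / t) ≤
        δ * ((3 / t - 1) * X ^ 2 + (X + e) ^ 2 / t) := by gcongr
    linarith
  have hXle := head_le_of_quadratic hδ0 ht0 he0 hν hΔ hquad
  -- Off `T` the entries are at most A/s ≤ X/√s in size, and their absolute values sum to at most
  -- √s(X + e).
  have htail2 : ∑ i ∈ Tᶜ, c' i ^ 2 ≤ X * (X + e) := by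
    refine (sum_compl_sq_le hs0 T c' hmin).trans ?_
    rw [div_mul_eq_mul_div, div_le_iff₀ hs0]
    have e1 : X * (X + e) * s = (r * X) * (r * X + 2 * η) := by rw [← hre, ← hrr]; ring
    rw [e1]
    exact mul_le_mul hAX (htail.trans (by linarith))
      (Finset.sum_nonneg fun i _ => abs_nonneg _) (by positivity)
  have hh : lpNorm 2 h ^ 2 ≤ 2 * X ^ 2 + X * e := by
    rw [← hD.sum_sq, ← hc]
    have : ∑ i, c i ^ 2 = ∑ i, c' i ^ 2 := by rw [Fintype.sum_sum_type]; simp [hc']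
    rw [this, ← Finset.sum_add_sum_compl T, hX2]; linarith
  exact lpNorm_arith hX0 he0 hh hXle

/-- The cone condition for the difference of a minimizer and the true signal. -/
theorem cone_of_lpNorm_one_le (F c xs : Fin d → ℝ) (hmin : lpNorm 1 (F + c) ≤ lpNorm 1 F) :
    ∑ i, |c i| ≤ 2 * ∑ i with xs i ≠ 0, |c i| + 2 * lpNorm 1 (F - xs) := by
  rw [lpNorm_one, lpNorm_one] at hmin
  rw [lpNorm_one, Finset.sum_filter, Finset.mul_sum, Finset.mul_sum, ← Finset.sum_add_distrib]
  -- By minimality the last bracket has nonpositive sum, so a coordinatewise bound is enough.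
  have : ∀ i, |c i| ≤ 2 * (if xs i ≠ 0 then |c i| else 0) + 2 * |(F - xs) i| +
      (|(F + c) i| - |F i|) := by
    intro i
    simp only [Pi.add_apply, Pi.sub_apply]
    by_cases h : xs i = 0
    · simp only [h, ne_eq, not_true_eq_false, if_false, sub_zero]
      have := abs_sub_abs_le_abs_sub (c i) (-F i)
      rw [abs_neg, sub_neg_eq_add, add_comm (c i)] at this
      linarith
    · simp only [ne_eq, h, not_false_eq_true, if_true]
      have := abs_sub_abs_le_abs_sub (F i) (-c i)
      rw [abs_neg, sub_neg_eq_add] at this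
      linarith [abs_nonneg (F i - xs i)]
  have h := Finset.sum_le_sum fun i (_ : i ∈ Finset.univ) => this i
  rw [Finset.sum_add_distrib, Finset.sum_sub_distrib] at h
  linarith

end Recovery

/-! ### Existence of solutions and recovery for the two constraint sets. -/

section Solutions
variable {M N d s : ℕ} {Φ : Matrix (Fin M) (Fin N) ℝ} {D : Matrix (Fin N) (Fin d) ℝ}

theorem continuous_lpNorm_one {n : ℕ} : Continuous (lpNorm 1 : (Fin n → ℝ) → ℝ) :=
  (PiLp.continuous_toLp 1 _).norm

theorem isClosed_setB₂ (M : ℕ) (σ : ℝ) : IsClosed (setB₂ M σ) :=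
  isClosed_le ((PiLp.continuous_toLp 2 _).norm.pow 2) continuous_const

theorem isClosed_setB₃ (Φ : Matrix (Fin M) (Fin N) ℝ) (D : Matrix (Fin N) (Fin d) ℝ) (σ : ℝ) :
    IsClosed (setB₃ Φ D σ) :=
  isClosed_le (((PiLp.continuous_toLp ∞ _).comp (continuous_const.matrix_mulVec
    (continuous_const.matrix_mulVec continuous_id))).norm.pow 2) continuous_const

/-- The `ℓ₁`-analysis problem over a closed set has a solution if it is feasible. -/
theorem IsTightFrame.exists_solution (hD : IsTightFrame D) {b : Fin M → ℝ} {B : Set (Fin M → ℝ)}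
    (hB : IsClosed B) (f : Fin N → ℝ) (hf : Φ *ᵥ f - b ∈ B) :
    ∃ g, IsL1AnalysisSolution Φ D b B g := by
  set r := lpNorm 1 (Dᵀ *ᵥ f) with hr
  have hcont : Continuous fun g : Fin N → ℝ => lpNorm 1 (Dᵀ *ᵥ g) :=
    continuous_lpNorm_one.comp (continuous_const.matrix_mulVec continuous_id)
  let K : Set (Fin N → ℝ) := {g | Φ *ᵥ g - b ∈ B} ∩ {g | lpNorm 1 (Dᵀ *ᵥ g) ≤ r}
  have hKc : IsClosed K := by
    refine IsClosed.inter (hB.preimage ?_) (isClosed_le hcont continuous_const)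
    exact (continuous_const.matrix_mulVec continuous_id).sub continuous_const
  have hKb : Bornology.IsBounded K := by
    refine (Metric.isBounded_closedBall (x := 0) (r := r)).subset fun g hg => ?_
    have hg2 : lpNorm 1 (Dᵀ *ᵥ g) ≤ r := hg.2
    have hr0 : 0 ≤ r := (norm_nonneg _ : 0 ≤ lpNorm 1 (Dᵀ *ᵥ g)).trans hg2
    rw [mem_closedBall_zero_iff, pi_norm_le_iff_of_nonneg hr0]
    intro i
    -- Sublevel sets are bounded because ‖g‖₂ = ‖D*g‖₂ ≤ ‖D*g‖₁.
    have h1 : g i ^ 2 ≤ r ^ 2 := by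
      calc g i ^ 2 ≤ ∑ i, g i ^ 2 :=
            Finset.single_le_sum (f := fun i => g i ^ 2) (fun i _ => sq_nonneg _)
              (Finset.mem_univ i)
        _ = ∑ i, (Dᵀ *ᵥ g) i ^ 2 := by
            rw [hD.sum_sq, lpNorm_two_sq]; simp [dotProduct, sq]
        _ = ∑ i, |(Dᵀ *ᵥ g) i| ^ 2 := by simp
        _ ≤ (∑ i, |(Dᵀ *ᵥ g) i|) ^ 2 :=
            Finset.sum_sq_le_sq_sum_of_nonneg fun i _ => abs_nonneg _
        _ ≤ r ^ 2 := by rw [← lpNorm_one]; exact pow_le_pow_left₀ (norm_nonneg _) hg2 2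
    exact abs_le_of_sq_le_sq h1 hr0
  obtain ⟨g, hg, hmin⟩ := (Metric.isCompact_of_isClosed_isBounded hKc hKb).exists_isMinOn
    ⟨f, hf, (le_refl r : lpNorm 1 (Dᵀ *ᵥ f) ≤ r)⟩ hcont.continuousOn
  refine ⟨g, hg.1, fun g' hg' => ?_⟩
  rcases le_total (lpNorm 1 (Dᵀ *ᵥ g')) r with h | h
  · exact hmin (show g' ∈ K from ⟨hg', h⟩)
  · exact (hmin (show f ∈ K from ⟨hf, (le_refl r : lpNorm 1 (Dᵀ *ᵥ f) ≤ r)⟩)).trans h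

theorem IsL1AnalysisSolution.cone {f g : Fin N → ℝ} {b : Fin M → ℝ} {B : Set (Fin M → ℝ)}
    (hg : IsL1AnalysisSolution Φ D b B g) (hf : Φ *ᵥ f - b ∈ B) (xs : Fin d → ℝ) :
    ∑ i, |(Dᵀ *ᵥ (g - f)) i| ≤ 2 * ∑ i with xs i ≠ 0, |(Dᵀ *ᵥ (g - f)) i| +
      2 * lpNorm 1 (Dᵀ *ᵥ f - xs) := by
  refine cone_of_lpNorm_one_le _ _ xs ?_
  rw [← Matrix.mulVec_add, add_sub_cancel]
  exact hg.2 f hf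

/-- The origin of t̃ in `constA`: the factor `t` comes from the quadratic inequality, the root from
the norm of Φ D on `s`-sparse vectors. -/
theorem mul_sqrt_max {t : ℝ} (ht : 0 < t) : t * √(max 1 (1 / t)) = max t (√t) := by
  rcases le_total 1 t with h | h
  · rw [max_eq_left ((div_le_one ht).2 h), Real.sqrt_one, mul_one, max_eq_left]
    exact (Real.sqrt_le_left ht.le).2 (by nlinarith)
  · rw [max_eq_right ((one_le_div ht).2 h), max_eq_right (Real.le_sqrt_of_sq_le (by nlinarith)),
      Real.sqrt_div zero_le_one, Real.sqrt_one, mul_one_div]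
    exact Real.div_sqrt

/-- Recovery for noise in the `ℓ₂` ball. -/
theorem recovery_setB₂ {t δ : ℝ} {σ : ℝ≥0} (hD : IsTightFrame D) (hs : 1 ≤ s) (ht0 : 0 < t)
    (ht : t < 4 / 3) (hts : 1 < t * s) (hδ0 : 0 ≤ δ) (hδ : δ < t / (4 - t))
    (hdrip : DRIP Φ D ⌈t * s⌉₊ δ) (f : Fin N → ℝ) (xs : Fin d → ℝ) (hxs : IsSparse s xs)
    {w : Fin M → ℝ} (hw : w ∈ setB₂ M σ) :
    (∃ g, IsL1AnalysisSolution Φ D (Φ *ᵥ f + w) (setB₂ M σ) g) ∧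
      ∀ g, IsL1AnalysisSolution Φ D (Φ *ᵥ f + w) (setB₂ M σ) g →
        lpNorm 2 (g - f) ≤ constA t δ * σ * √(M + 2 * √(M * Real.log M)) +
          constB t δ * (lpNorm 1 (Dᵀ *ᵥ f - xs) / √s) := by
  have hδ1 : δ ≤ 1 := by
    refine hδ.le.trans ?_
    rw [div_le_one (by linarith)]; linarith
  have hf : Φ *ᵥ f - (Φ *ᵥ f + w) ∈ setB₂ M σ := by
    have e : Φ *ᵥ f - (Φ *ᵥ f + w) = -w := by abel
    rw [e]
    have : lpNorm 2 (-w) ^ 2 = lpNorm 2 w ^ 2 := by rw [lpNorm_two_sq, lpNorm_two_sq]; simp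
    rw [setB₂, Set.mem_ofPred_eq, this]; exact hw
  refine ⟨hD.exists_solution (isClosed_setB₂ M σ) f hf, fun g hg => ?_⟩
  set ε := σ * √(M + 2 * √(M * Real.log M)) with hε
  have hε0 : 0 ≤ ε := by positivity
  have hball : ∀ v ∈ setB₂ M σ, lpNorm 2 v ≤ ε := by
    intro v hv
    refine (abs_le_of_sq_le_sq' ?_ hε0).2
    rw [hε, mul_pow, Real.sq_sqrt (by positivity)]; exact hv
  have hΦ : lpNorm 2 (Φ *ᵥ (g - f)) ≤ 2 * ε := by
    have e : Φ *ᵥ (g - f) = (Φ *ᵥ g - (Φ *ᵥ f + w)) + w := by rw [Matrix.mulVec_sub]; abel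
    rw [e]
    have : lpNorm 2 (Φ *ᵥ g - (Φ *ᵥ f + w) + w) ≤
        lpNorm 2 (Φ *ᵥ g - (Φ *ᵥ f + w)) + lpNorm 2 w :=
      norm_add_le (WithLp.toLp 2 (Φ *ᵥ g - (Φ *ᵥ f + w))) (WithLp.toLp 2 w)
    linarith [hball _ hg.1, hball _ hw]
  have hmain := hdrip.lpNorm_le_of_cone (ν := √((1 + δ) * max 1 (1 / t)) * (2 * ε)) hD hs ht0 ht
    hts hδ0 hδ (g - f) (norm_nonneg (WithLp.toLp 1 (Dᵀ *ᵥ f - xs))) (by positivity) _ hxs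
    (hg.cone hf xs) fun x hx => by
      refine (dotProduct_le_lpNorm_mul _ _).trans ?_
      have h1 : lpNorm 2 (Φ *ᵥ (D *ᵥ x)) ≤ √((1 + δ) * max 1 (1 / t)) * √(∑ i, x i ^ 2) := by
        rw [← Real.sqrt_mul (by positivity)]
        exact Real.le_sqrt_of_sq_le (hdrip.lpNorm_sq_le hD hs ht0 hts hδ0 hδ1 x hx)
      refine (mul_le_mul h1 hΦ (lpNorm_two_nonneg _) (by positivity)).trans (le_of_eq (by ring))
  refine hmain.trans (le_of_eq ?_)
  congr 1
  rw [Real.sqrt_mul (by linarith), constA, ← mul_sqrt_max ht0, hε]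
  ring

/-- Recovery for noise in the Dantzig type constraint set. -/
theorem recovery_setB₃ {t δ : ℝ} {σ : ℝ≥0} (hD : IsTightFrame D) (hs : 1 ≤ s) (ht0 : 0 < t)
    (ht : t < 4 / 3) (hts : 1 < t * s) (hδ0 : 0 ≤ δ) (hδ : δ < t / (4 - t))
    (hdrip : DRIP Φ D ⌈t * s⌉₊ δ) (f : Fin N → ℝ) (xs : Fin d → ℝ) (hxs : IsSparse s xs)
    {w : Fin M → ℝ} (hw : w ∈ setB₃ Φ D σ) :
    (∃ g, IsL1AnalysisSolution Φ D (Φ *ᵥ f + w) (setB₃ Φ D σ) g) ∧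
      ∀ g, IsL1AnalysisSolution Φ D (Φ *ᵥ f + w) (setB₃ Φ D σ) g →
        lpNorm 2 (g - f) ≤ 2 * √2 * constC s t δ * σ * √(Real.log d) +
          constB t δ * (lpNorm 1 (Dᵀ *ᵥ f - xs) / √s) := by
  have hΔ : 0 < t + (t - 4) * δ := by
    rw [lt_div_iff₀ (by linarith)] at hδ; linarith
  have hf : Φ *ᵥ f - (Φ *ᵥ f + w) ∈ setB₃ Φ D σ := by
    have e : Φ *ᵥ f - (Φ *ᵥ f + w) = -w := by abel
    have : lpNorm ∞ (Dᵀ *ᵥ (Φᵀ *ᵥ (-w))) = lpNorm ∞ (Dᵀ *ᵥ (Φᵀ *ᵥ w)) := by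
      rw [Matrix.mulVec_neg, Matrix.mulVec_neg, lpNorm, WithLp.toLp_neg, norm_neg]; rfl
    rw [e, setB₃, Set.mem_ofPred_eq, this]; exact hw
  refine ⟨hD.exists_solution (isClosed_setB₃ Φ D σ) f hf, fun g hg => ?_⟩
  have hlog : 0 ≤ Real.log d := Real.log_natCast_nonneg d
  set ε := 2 * √2 * (σ * √(Real.log d)) with hε
  have hε0 : 0 ≤ ε := by positivity
  have hball : ∀ v ∈ setB₃ Φ D σ, ∀ i, |(Dᵀ *ᵥ (Φᵀ *ᵥ v)) i| ≤ ε := by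
    intro v hv i
    refine (abs_le_lpNorm_top _ i).trans (abs_le_of_sq_le_sq' ?_ hε0).2
    have e : ε ^ 2 = 8 * σ ^ 2 * Real.log d := by
      rw [hε, mul_pow, mul_pow, mul_pow, Real.sq_sqrt hlog, Real.sq_sqrt (by norm_num)]; ring
    rw [e]; exact hv
  have hΦ : ∀ i, |(Dᵀ *ᵥ (Φᵀ *ᵥ (Φ *ᵥ (g - f)))) i| ≤ 2 * ε := by
    intro i
    have e : Φ *ᵥ (g - f) = (Φ *ᵥ g - (Φ *ᵥ f + w)) + w := by rw [Matrix.mulVec_sub]; abel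
    rw [e, Matrix.mulVec_add, Matrix.mulVec_add, Pi.add_apply]
    refine (abs_add_le _ _).trans ?_
    linarith [hball _ hg.1 i, hball _ hw i]
  -- Hölder: the sup bound 2ε on D*Φ*Φh is paired with ‖x‖₁ ≤ √s‖x‖₂.
  have hmain := hdrip.lpNorm_le_of_cone (ν := √s * (2 * ε)) hD hs ht0 ht
    hts hδ0 hδ (g - f) (norm_nonneg (WithLp.toLp 1 (Dᵀ *ᵥ f - xs))) (by positivity) _ hxs
    (hg.cone hf xs) fun x hx => by
      rw [← dotProduct_transpose_mulVec, ← dotProduct_transpose_mulVec]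
      have h1 : ∑ i, |x i| ≤ √s * √(∑ i, x i ^ 2) := by
        have h2 := sum_abs_le_sqrt_mul (Finset.univ.filter fun i => x i ≠ 0) x
        rw [Finset.sum_filter_of_ne fun i _ h => by simpa using h,
          Finset.sum_filter_of_ne fun i _ h => by simpa using h] at h2
        refine h2.trans (mul_le_mul_of_nonneg_right (Real.sqrt_le_sqrt ?_) (Real.sqrt_nonneg _))
        exact_mod_cast hx
      calc _ ≤ ∑ i, |x i| * (2 * ε) := by
            refine Finset.sum_le_sum fun i _ => (le_abs_self _).trans ?_
            rw [abs_mul]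
            exact mul_le_mul_of_nonneg_left (hΦ i) (abs_nonneg _)
        _ = (∑ i, |x i|) * (2 * ε) := by rw [Finset.sum_mul]
        _ ≤ (√s * √(∑ i, x i ^ 2)) * (2 * ε) := by gcongr
        _ = _ := by ring
  refine hmain.trans (add_le_add_left ?_ _)
  have hr0 : 0 ≤ √(s : ℝ) := Real.sqrt_nonneg _
  rw [constC, Real.sqrt_mul (by norm_num)]
  calc √2 * (t * (√s * (2 * ε))) / (t + (t - 4) * δ)
      ≤ √2 * (max t (√t) * (√s * (2 * ε))) / (t + (t - 4) * δ) := by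
        gcongr; exact le_max_left _ _
    _ = _ := by rw [hε]; ring

end Solutions

/-! ### Real inequalities behind the χ² tail. -/

section RealBounds
open Real

/-- The difference of the sides has derivative y³/(1+y) ≥ 0. -/
theorem log_one_add_le {x : ℝ} (hx : 0 ≤ x) : log (1 + x) ≤ x - x ^ 2 / 2 + x ^ 3 / 3 := by
  have hd : ∀ y ∈ Set.Ici (0 : ℝ), HasDerivAt (fun y => y - y ^ 2 / 2 + y ^ 3 / 3 - log (1 + y))
      (y ^ 3 / (1 + y)) y := by
    intro y hy
    have hy0 : (0 : ℝ) ≤ y := hy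
    have h1 : (1 + y) ≠ 0 := by positivity
    have h2 := ((hasDerivAt_id y).const_add 1).log h1
    have h3 := (((hasDerivAt_id y).sub ((hasDerivAt_pow 2 y).div_const 2)).add
      ((hasDerivAt_pow 3 y).div_const 3)).sub h2
    convert! h3 using 1
    simp only [id]
    field_simp
    ring
  have hm : MonotoneOn (fun y => y - y ^ 2 / 2 + y ^ 3 / 3 - log (1 + y)) (Set.Ici (0 : ℝ)) := by
    refine monotoneOn_of_deriv_nonneg (convex_Ici 0)
      (fun y hy => (hd y hy).continuousAt.continuousWithinAt)
      (fun y hy => (hd y (interior_subset hy)).differentiableAt.differentiableWithinAt)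
      fun y hy => ?_
    have hy0 : (0 : ℝ) ≤ y := interior_subset hy
    rw [(hd y hy0).deriv]; positivity
  have := hm (Set.mem_Ici.2 le_rfl) (Set.mem_Ici.2 hx) hx
  simp at this
  linarith

/-- The cube of x/u ≤ exp(x/u − 1). The sign condition covers x ≤ u ≤ 3 and u = 3, the maximum point
of x³e⁻ˣ. -/
theorem cube_mul_exp_neg_le {x u : ℝ} (hx : 0 ≤ x) (hu : 0 < u) (h : (3 / u - 1) * (x - u) ≤ 0) :
    x ^ 3 * exp (-x) ≤ u ^ 3 * exp (-u) := by
  have h1 : x / u ≤ exp (x / u - 1) := by linarith [add_one_le_exp (x / u - 1)]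
  have h2 : x ^ 3 ≤ u ^ 3 * exp (3 * (x / u - 1)) := by
    have := pow_le_pow_left₀ (by positivity) h1 3
    rw [← exp_nat_mul, div_pow, div_le_iff₀ (by positivity)] at this
    push_cast at this; linarith
  calc x ^ 3 * exp (-x) ≤ u ^ 3 * exp (3 * (x / u - 1)) * exp (-x) := by gcongr
    _ = u ^ 3 * exp ((3 / u - 1) * (x - u) - u) := by
      rw [mul_assoc, ← exp_add]; congr 2; field_simp; ring
    _ ≤ u ^ 3 * exp (-u) := by gcongr; linarith

/-- The elementary inequality behind the `χ²` tail estimate. -/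
theorem exp_mul_le_four_pi_mul {x y : ℝ} (hx : log 2 ≤ x)
    (hxy : y ^ 2 = x ^ 3 * exp (-x)) : exp (8 / 3 * y) ≤ 4 * π * x := by
  have hl := log_two_gt_d9
  have hx0 : 0 < x := by linarith
  have he := exp_one_gt_d9
  have he' := exp_one_lt_d9
  have hπ := pi_gt_d2
  have key : ∀ (u b : ℝ), 0 < u → (3 / u - 1) * (x - u) ≤ 0 → u ^ 3 ≤ b ^ 2 * exp u → 0 ≤ b →
      y ≤ b := by
    intro u b hu h hb hb0
    have h1 := cube_mul_exp_neg_le hx0.le hu h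
    refine abs_le_of_sq_le_sq' ?_ hb0 |>.2
    rw [hxy]
    refine h1.trans ?_
    rw [exp_neg, ← div_eq_mul_inv, div_le_iff₀ (exp_pos u)]; exact hb
  have fin : ∀ (b l v : ℝ), y ≤ b → l ≤ x → exp (8 / 3 * b) ≤ v → v ≤ 4 * 3.14 * l → 0 < l →
      exp (8 / 3 * y) ≤ 4 * π * x := by
    intro b l v hb hlx hv hv' hl
    calc exp (8 / 3 * y) ≤ exp (8 / 3 * b) := by gcongr
      _ ≤ v := hv
      _ ≤ 4 * 3.14 * l := hv'
      _ ≤ 4 * π * x := by gcongr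
  have e2 : exp 2 = exp 1 ^ 2 := by rw [← exp_nat_mul]; norm_num
  have e3 : exp 3 = exp 1 ^ 3 := by rw [← exp_nat_mul]; norm_num
  have f2 : exp 2 ≤ 7.39 := by
    rw [e2]; exact (pow_le_pow_left₀ (exp_pos 1).le he'.le 2).trans (by norm_num)
  have f3 : exp 3 ≤ 20.086 := by
    rw [e3]; exact (pow_le_pow_left₀ (exp_pos 1).le he'.le 3).trans (by norm_num)
  have g2 : 7.38 ≤ exp 2 := by
    rw [e2]; exact le_trans (by norm_num) (pow_le_pow_left₀ (by norm_num) he.le 2)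
  have g3 : 20.08 ≤ exp 3 := by
    rw [e3]; exact le_trans (by norm_num) (pow_le_pow_left₀ (by norm_num) he.le 3)
  -- On each interval `y` is bounded through x³e⁻ˣ at the right end, or at its peak 3 on the last
  -- interval, while `x` is bounded below by the left end; 0.69 stands for log 2.
  rcases le_total x 1.1 with h1 | h1
  · refine fin 0.75 0.69 7.39 (key 1.1 0.75 (by norm_num) ?_ ?_ (by norm_num)) (by linarith)
      (by norm_num; exact f2.trans (by norm_num)) (by norm_num) (by norm_num)
    · exact mul_nonpos_of_nonneg_of_nonpos (by norm_num) (by linarith)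
    · have : (2.718 : ℝ) ≤ exp 1.1 := by
        refine le_trans ?_ (exp_le_exp.2 (by norm_num : (1 : ℝ) ≤ 1.1)); linarith
      linarith
  rcases le_total x 1.6 with h2 | h2
  · refine fin 0.9375 1.1 13.8 (key 1.6 0.9375 (by norm_num) ?_ ?_ (by norm_num)) h1 ?_
      (by norm_num) (by norm_num)
    · exact mul_nonpos_of_nonneg_of_nonpos (by norm_num) (by linarith)
    · have e : exp 1.6 = exp 1 * exp 0.6 := by rw [← exp_add]; norm_num
      have : (1.78 : ℝ) ≤ exp 0.6 := by
        have := quadratic_le_exp_of_nonneg (x := 0.6) (by norm_num)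
        norm_num at this ⊢; linarith
      have : 2.718 * 1.78 ≤ exp 1.6 := by
        rw [e]; exact mul_le_mul (by linarith) this (by norm_num) (exp_pos 1).le
      linarith
    · have e : exp (8 / 3 * 0.9375) ^ 2 = exp 2 * exp 3 := by
        rw [← exp_nat_mul, ← exp_add]; norm_num
      refine abs_le_of_sq_le_sq' ?_ (by norm_num) |>.2
      rw [e]
      exact (mul_le_mul f2 f3 (exp_pos 3).le (by norm_num)).trans (by norm_num)
  rcases le_total x 2 with h3 | h3
  · refine fin 1.125 1.6 20.086 (key 2 1.125 (by norm_num) ?_ ?_ (by norm_num)) h2 ?_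
      (by norm_num) (by norm_num)
    · exact mul_nonpos_of_nonneg_of_nonpos (by norm_num) (by linarith)
    · linarith
    · norm_num; exact f3.trans (by norm_num)
  · refine fin 1.1625 2 22.5 (key 3 1.1625 (by norm_num) ?_ ?_ (by norm_num)) h3 ?_
      (by norm_num) (by norm_num)
    · norm_num
    · linarith
    · have e : exp (8 / 3 * 1.1625) = exp 3 * exp 0.1 := by rw [← exp_add]; norm_num
      have h : exp 0.1 ≤ 1.12 := by
        have h1 := add_one_le_exp (-0.1 : ℝ)
        rw [exp_neg] at h1
        have h2 := exp_pos 0.1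
        rw [le_inv_comm₀ (by norm_num) h2] at h1
        refine h1.trans (by norm_num)
      rw [e]
      exact (mul_le_mul f3 h (exp_pos _).le (by norm_num)).trans (by norm_num)

/-- Stirling's lower bound at half-integers. -/
theorem le_Gamma_half_sq {n : ℕ} (hn : 1 ≤ n) :
    4 * π / n * (n / (2 * exp 1)) ^ n ≤ Gamma (n / 2) ^ 2 := by
  have hn0 : (0 : ℝ) < n := by exact_mod_cast hn
  set a : ℝ := n / 2 with ha
  have ha0 : 0 < a := by positivity
  have hG0 := Gamma_pos_of_pos ha0
  have hdup := Gamma_mul_Gamma_add_half a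
  -- Log-convexity of Γ between a and a + 1 turns the duplication formula into a lower bound for
  -- Γ(a)².
  have hconv : Gamma (a + 1 / 2) ≤ Gamma a * √a := by
    have := Gamma_mul_add_mul_le_rpow_Gamma_mul_rpow_Gamma ha0 (by linarith : 0 < a + 1)
      (a := 1 / 2) (b := 1 / 2) (by norm_num) (by norm_num) (by norm_num)
    rw [← sqrt_eq_rpow, ← sqrt_eq_rpow, Gamma_add_one ha0.ne', ← sqrt_mul hG0.le] at this
    have e : Gamma a * (a * Gamma a) = Gamma a ^ 2 * a := by ring
    rw [e, sqrt_mul (sq_nonneg _), sqrt_sq hG0.le] at this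
    convert this using 2; ring
  have hfact : √(2 * π * n) * (n / exp 1) ^ n / n ≤ Gamma (2 * a) := by
    have e : 2 * a = n := by rw [ha]; ring
    rw [e, div_le_iff₀ hn0, mul_comm (Gamma _), ← Gamma_add_one hn0.ne', Gamma_nat_eq_factorial]
    exact Stirling.le_factorial_stirling n
  have h2 : (2 : ℝ) ^ (1 - 2 * a) = 2 / 2 ^ n := by
    rw [ha, show (1 : ℝ) - 2 * (n / 2) = 1 - n by ring, rpow_sub two_pos, rpow_one, rpow_natCast]
  rw [h2] at hdup
  have h3 : Gamma (2 * a) * (2 / 2 ^ n) * √π ≤ Gamma a ^ 2 * √a := by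
    rw [← hdup, sq, mul_assoc]; gcongr
  have hs : 0 < √a := sqrt_pos.2 ha0
  refine le_of_mul_le_mul_right (le_trans (le_of_eq ?_) ((mul_le_mul_of_nonneg_right
    (mul_le_mul_of_nonneg_right hfact (by positivity : (0 : ℝ) ≤ 2 / 2 ^ n))
    (sqrt_nonneg π)).trans h3)) hs
  have e1 : √(2 * π * n) = 2 * √π * √a := by
    rw [show 2 * π * n = 2 ^ 2 * (π * a) by rw [ha]; ring, sqrt_mul (by norm_num),
      sqrt_sq (by norm_num), sqrt_mul pi_pos.le]; ring
  have e2 : √π * √π = π := mul_self_sqrt pi_pos.le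
  rw [e1, div_pow, div_pow, mul_pow]
  field_simp
  rw [show √π ^ 2 = π by rw [sq, e2]]
  ring

/-- `∫₀^∞ r^(n-1) exp(-r²/2) dr` in terms of the Gamma function. -/
theorem integral_pow_mul_exp (n : ℕ) (hn : 1 ≤ n) :
    ∫ r in Set.Ioi (0 : ℝ), r ^ (n - 1) * exp (-(r ^ 2) / 2) =
      (2 : ℝ) ^ ((n : ℝ) / 2) / 2 * Gamma (n / 2) := by
  have h := integral_rpow_mul_exp_neg_mul_rpow (p := 2) (q := ((n - 1 : ℕ) : ℝ)) (b := 1 / 2)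
    (by norm_num) (lt_of_lt_of_le (by norm_num) (Nat.cast_nonneg _)) (by norm_num)
  have hc : ((n - 1 : ℕ) : ℝ) + 1 = n := by exact_mod_cast Nat.sub_add_cancel hn
  have e : ∫ r in Set.Ioi (0 : ℝ), r ^ (n - 1) * exp (-(r ^ 2) / 2) =
      ∫ x in Set.Ioi (0 : ℝ), x ^ ((n - 1 : ℕ) : ℝ) * exp (-(1 / 2) * x ^ (2 : ℝ)) := by
    refine setIntegral_congr_fun measurableSet_Ioi fun r _ => ?_
    simp only [rpow_natCast, rpow_two]
    congr 2; ring
  rw [e, h, hc, one_div, inv_rpow two_pos.le, neg_div, rpow_neg two_pos.le, inv_inv]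
  ring

/-- The weight r² − n makes the radial density exactly integrable. Beyond R with R² > n it is at
least R² − n, which gives the tail bound. -/
theorem hasDerivAt_pow_mul_exp (n : ℕ) (hn : 1 ≤ n) (r : ℝ) :
    HasDerivAt (fun r : ℝ => -(r ^ n * exp (-(r ^ 2) / 2)))
      ((r ^ 2 - n) * (r ^ (n - 1) * exp (-(r ^ 2) / 2))) r := by
  have h1 : HasDerivAt (fun r : ℝ => -(r ^ 2) / 2) (-r) r := by
    have := ((hasDerivAt_pow 2 r).neg).div_const 2
    convert! this using 1; simp; ring
  have h := ((hasDerivAt_pow n r).mul h1.exp).neg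
  convert! h using 1
  obtain ⟨k, rfl⟩ : ∃ k, n = k + 1 := ⟨n - 1, by omega⟩
  simp only [Nat.add_sub_cancel]
  ring

theorem tendsto_pow_mul_exp (n : ℕ) :
    Filter.Tendsto (fun r : ℝ => -(r ^ n * exp (-(r ^ 2) / 2))) Filter.atTop (nhds 0) := by
  have h1 : Filter.Tendsto (fun r : ℝ => r ^ n * exp (-r)) Filter.atTop (nhds 0) :=
    tendsto_pow_mul_exp_neg_atTop_nhds_zero n
  rw [← neg_zero]
  refine Filter.Tendsto.neg (squeeze_zero' ?_ ?_ h1)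
  · filter_upwards [Filter.eventually_ge_atTop 0] with r hr; positivity
  · filter_upwards [Filter.eventually_ge_atTop 2] with r hr
    gcongr
    nlinarith

/-- Tail of the radial integral. -/
theorem integral_Ioi_pow_mul_exp_le (n : ℕ) (hn : 1 ≤ n) {R : ℝ} (hR0 : 0 ≤ R) (hR : n < R ^ 2) :
    ∫ r in Set.Ioi R, r ^ (n - 1) * exp (-(r ^ 2) / 2) ≤
      R ^ n * exp (-(R ^ 2) / 2) / (R ^ 2 - n) := by
  have hpos : ∀ r ∈ Set.Ioi R, 0 ≤ (r ^ 2 - n) * (r ^ (n - 1) * exp (-(r ^ 2) / 2)) := by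
    intro r hr
    have hr' : R < r := hr
    have h1 : R ^ 2 ≤ r ^ 2 := pow_le_pow_left₀ hR0 hr'.le 2
    have h2 : 0 ≤ r := hR0.trans hr'.le
    exact mul_nonneg (by linarith) (by positivity)
  have hint := integrableOn_Ioi_deriv_of_nonneg' (fun r _ => hasDerivAt_pow_mul_exp n hn r) hpos
    (tendsto_pow_mul_exp n)
  have heq := integral_Ioi_of_hasDerivAt_of_nonneg' (fun r _ => hasDerivAt_pow_mul_exp n hn r) hpos
    (tendsto_pow_mul_exp n)
  have hd : 0 < R ^ 2 - n := by linarith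
  rw [le_div_iff₀ hd, mul_comm, ← integral_const_mul]
  calc ∫ r in Set.Ioi R, (R ^ 2 - n) * (r ^ (n - 1) * exp (-(r ^ 2) / 2))
      ≤ ∫ r in Set.Ioi R, (r ^ 2 - n) * (r ^ (n - 1) * exp (-(r ^ 2) / 2)) := by
        refine integral_mono_of_nonneg ?_ hint ?_
        · filter_upwards [ae_restrict_mem measurableSet_Ioi] with r hr
          have hr' : R < r := hr
          have h2 : 0 ≤ r := hR0.trans hr'.le
          simp only [Pi.zero_apply]; positivity
        · filter_upwards [ae_restrict_mem measurableSet_Ioi] with r hr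
          have hr' : R < r := hr
          have h1 : R ^ 2 ≤ r ^ 2 := pow_le_pow_left₀ hR0 hr'.le 2
          have h2 : 0 ≤ r := hR0.trans hr'.le
          refine mul_le_mul_of_nonneg_right (by linarith) (by positivity)
    _ = R ^ n * exp (-(R ^ 2) / 2) := by rw [heq]; ring

/-- The ratio of the radial integrals for the radius `√(n + 2 √(n log n))`. -/
theorem radial_ratio_le (n : ℕ) (hn : 2 ≤ n) :
    n * ∫ r in Set.Ioi (√(n + 2 * √(n * log n))), r ^ (n - 1) * exp (-(r ^ 2) / 2) ≤
      ∫ r in Set.Ioi (0 : ℝ), r ^ (n - 1) * exp (-(r ^ 2) / 2) := by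
  have hn0 : (0 : ℝ) < n := by exact_mod_cast (by omega : 0 < n)
  set L := log n with hL
  have hL2 : log 2 ≤ L := log_le_log two_pos (by exact_mod_cast hn)
  have hL0 : 0 < L := lt_of_lt_of_le (log_pos (by norm_num)) hL2
  set q := √(n * L) with hq
  have hq0 : 0 < q := sqrt_pos.2 (by positivity)
  have hq2 : q ^ 2 = n * L := sq_sqrt (by positivity)
  set R := √(n + 2 * q) with hR
  have hR0 : 0 ≤ R := sqrt_nonneg _
  have hR2 : R ^ 2 = n + 2 * q := sq_sqrt (by positivity)
  have htail := integral_Ioi_pow_mul_exp_le n (by omega) hR0 (by rw [hR2]; linarith)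
  rw [hR2, add_sub_cancel_left] at htail
  set I := ∫ r in Set.Ioi R, r ^ (n - 1) * exp (-(r ^ 2) / 2)
  rw [integral_pow_mul_exp n (by omega)]
  refine le_trans (mul_le_mul_of_nonneg_left htail hn0.le) ?_
  refine abs_le_of_sq_le_sq' ?_ (mul_nonneg (by positivity) (Gamma_nonneg_of_nonneg (by positivity)))
    |>.2
  have hG := le_Gamma_half_sq (n := n) (by omega)
  have e1 : ((2 : ℝ) ^ ((n : ℝ) / 2) / 2 * Gamma (n / 2)) ^ 2 = 2 ^ n / 4 * Gamma (n / 2) ^ 2 := by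
    rw [mul_pow, div_pow, ← rpow_natCast ((2 : ℝ) ^ ((n : ℝ) / 2)), ← rpow_mul two_pos.le,
      ← rpow_natCast 2 n]
    norm_num
  rw [e1]
  refine le_trans ?_ (mul_le_mul_of_nonneg_left hG (by positivity))
  have e2 : (2 : ℝ) ^ n / 4 * (4 * π / n * (n / (2 * exp 1)) ^ n) =
      π / n * (n ^ n * exp (-n)) := by
    rw [div_pow, mul_pow, ← exp_nat_mul, mul_one, exp_neg]
    field_simp
  have e3 : (n * (R ^ n * exp (-(n + 2 * q) / 2) / (2 * q))) ^ 2 =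
      n ^ 2 * (n + 2 * q) ^ n * exp (-(n + 2 * q)) / (4 * n * L) := by
    rw [mul_pow, div_pow, mul_pow, mul_pow, ← pow_mul, mul_comm n 2, pow_mul, hR2, hq2,
      ← exp_nat_mul]
    have : ((2 : ℕ) : ℝ) * (-(n + 2 * q) / 2) = -(n + 2 * q) := by push_cast; ring
    rw [this]; ring
  rw [e2, e3]
  -- logarithmic form
  set lam := 2 * q / n with hlam
  have hlam0 : 0 ≤ lam := by positivity
  have hpow : ((n : ℝ) + 2 * q) ^ n = n ^ n * (1 + lam) ^ n := by
    rw [← mul_pow]; congr 1; rw [hlam]; field_simp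
  -- Here λ = 2√(L/n). The linear term is cancelled by exp(−2q), the quadratic one by the factor n²,
  -- and the cubic one remains for `exp_mul_le_four_pi_mul` with y = Lq/n, y² = L³e⁻ᴸ.
  have hlog : (1 + lam) ^ n ≤ exp (2 * q - 2 * L + 8 / 3 * (L * q / n)) := by
    have h1 : (1 + lam) ≤ exp (lam - lam ^ 2 / 2 + lam ^ 3 / 3) := by
      rw [← log_le_iff_le_exp (by positivity)]; exact log_one_add_le hlam0
    have h2 := pow_le_pow_left₀ (by positivity) h1 n
    rw [← exp_nat_mul] at h2
    refine h2.trans (le_of_eq (congrArg exp ?_))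
    have c1 : lam ^ 2 = 4 * L / n := by rw [hlam, div_pow, mul_pow, hq2]; field_simp; ring
    have c2 : lam ^ 3 = 8 * L * q / n ^ 2 := by
      rw [pow_succ, c1, hlam]; field_simp; ring
    rw [c1, c2, hlam]; field_simp; ring
  have hnum : exp (8 / 3 * (L * q / n)) ≤ 4 * π * L := by
    refine exp_mul_le_four_pi_mul hL2 ?_
    rw [exp_neg, hL, exp_log hn0, ← hL, div_pow, mul_pow, hq2]; field_simp
  have hn2 : exp (2 * L) = n ^ 2 := by
    rw [two_mul, exp_add, hL, exp_log hn0, sq]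
  have hmain : (n : ℝ) ^ 2 * (1 + lam) ^ n ≤ exp (2 * q) * (4 * π * L) := by
    calc (n : ℝ) ^ 2 * (1 + lam) ^ n
        ≤ exp (2 * L) * exp (2 * q - 2 * L + 8 / 3 * (L * q / n)) := by rw [hn2]; gcongr
      _ = exp (2 * q) * exp (8 / 3 * (L * q / n)) := by rw [← exp_add, ← exp_add]; congr 1; ring
      _ ≤ _ := by gcongr
  rw [div_le_iff₀ (by positivity), hpow, neg_add, exp_add, exp_neg (2 * q)]
  have := mul_le_mul_of_nonneg_left hmain (by positivity :
    (0 : ℝ) ≤ n ^ n * exp (-n) * (exp (2 * q))⁻¹)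
  calc _ = (n : ℝ) ^ n * exp (-n) * (exp (2 * q))⁻¹ * (n ^ 2 * (1 + lam) ^ n) := by ring
    _ ≤ _ := this
    _ = _ := by field_simp

end RealBounds

/-! ### Gaussian tail estimates. -/

section Gaussian
open Real

theorem integrable_exp_neg_norm_sq (n : ℕ) :
    Integrable fun x : EuclideanSpace ℝ (Fin n) => exp (-(‖x‖ ^ 2) / 2) := by
  have h := (GaussianFourier.integrable_cexp_neg_mul_sq_norm_add (b := 1 / 2) (by norm_num) 0
    (0 : EuclideanSpace ℝ (Fin n))).norm
  refine h.congr (Filter.Eventually.of_forall fun x => ?_)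
  simp only [Complex.norm_exp]
  congr 1
  have : (-(1 / 2) * (‖x‖ : ℂ) ^ 2 + 0 * (inner ℝ 0 x : ℝ)) = ((-(‖x‖ ^ 2) / 2 : ℝ) : ℂ) := by
    push_cast; ring
  rw [this, Complex.ofReal_re]

/-- The density of the standard Gaussian measure. -/
theorem stdGaussian_eq_withDensity (n : ℕ) :
    stdGaussian (EuclideanSpace ℝ (Fin n)) = volume.withDensity fun x =>
      ENNReal.ofReal (((2 * π) ^ ((n : ℝ) / 2))⁻¹ * exp (-(‖x‖ ^ 2) / 2)) := by
  set C : ℝ := (2 * π) ^ ((n : ℝ) / 2) with hC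
  have hC0 : 0 < C := by positivity
  have hint := (integrable_exp_neg_norm_sq n).const_mul C⁻¹
  have := isFiniteMeasure_withDensity_ofReal hint.2
  refine Measure.ext_of_charFun ?_
  ext t
  rw [charFun_stdGaussian, charFun_apply, integral_withDensity_eq_integral_toReal_smul
    (by fun_prop) (Filter.Eventually.of_forall fun x => ENNReal.ofReal_lt_top)]
  have h := GaussianFourier.integral_cexp_neg_mul_sq_norm_add (b := 1 / 2) (by norm_num) Complex.I t
  have e : ∀ x : EuclideanSpace ℝ (Fin n),
      (ENNReal.ofReal (C⁻¹ * exp (-(‖x‖ ^ 2) / 2))).toReal •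
        Complex.exp ((inner ℝ x t : ℝ) * Complex.I) =
      (C : ℂ)⁻¹ * Complex.exp (-(1 / 2) * (‖x‖ : ℂ) ^ 2 + Complex.I * (inner ℝ t x : ℝ)) := by
    intro x
    rw [ENNReal.toReal_ofReal (by positivity), Complex.real_smul, Complex.exp_add,
      real_inner_comm x t]
    push_cast
    rw [mul_assoc]
    congr 3
    · ring
    · ring
  simp only [e]
  rw [integral_const_mul, h]
  have hCc : ((π : ℂ) / (1 / 2)) ^ ((Module.finrank ℝ (EuclideanSpace ℝ (Fin n)) : ℂ) / 2) =
      (C : ℂ) := by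
    rw [hC, Complex.ofReal_cpow (by positivity)]
    simp
    ring_nf
  rw [hCc, ← mul_assoc, inv_mul_cancel₀ (by exact_mod_cast hC0.ne'), one_mul]
  congr 1
  rw [Complex.I_sq]; ring

/-- Radial sets under the standard Gaussian measure. -/
theorem stdGaussian_norm_gt (n : ℕ) (hn : 1 ≤ n) {R : ℝ} (hR : 0 ≤ R) :
    (stdGaussian (EuclideanSpace ℝ (Fin n))).real {x | R < ‖x‖} *
        ∫ r in Set.Ioi (0 : ℝ), r ^ (n - 1) * exp (-(r ^ 2) / 2) =
      ∫ r in Set.Ioi R, r ^ (n - 1) * exp (-(r ^ 2) / 2) := by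
  have : Nonempty (Fin n) := ⟨⟨0, hn⟩⟩
  have hdim : Module.finrank ℝ (EuclideanSpace ℝ (Fin n)) = n := by simp
  set C : ℝ := ((2 * π) ^ ((n : ℝ) / 2))⁻¹ with hC
  have hC0 : 0 < C := by positivity
  set V : ℝ := C * (n * (volume : Measure (EuclideanSpace ℝ (Fin n))).real (Metric.ball 0 1))
    with hV
  have key : ∀ S : Set ℝ, MeasurableSet S →
      (stdGaussian (EuclideanSpace ℝ (Fin n))).real {x | ‖x‖ ∈ S} =
        V * ∫ r in Set.Ioi (0 : ℝ) ∩ S, r ^ (n - 1) * exp (-(r ^ 2) / 2) := by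
    intro S hS
    have hmeas : MeasurableSet {x : EuclideanSpace ℝ (Fin n) | ‖x‖ ∈ S} := measurable_norm hS
    rw [stdGaussian_eq_withDensity, measureReal_def, withDensity_apply _ hmeas,
      ← ofReal_integral_eq_lintegral_ofReal
        ((integrable_exp_neg_norm_sq n).const_mul C).integrableOn
        (Filter.Eventually.of_forall fun x => by positivity),
      ENNReal.toReal_ofReal (integral_nonneg fun x => by positivity), integral_const_mul,
      ← integral_indicator hmeas]
    have e : ({x : EuclideanSpace ℝ (Fin n) | ‖x‖ ∈ S}.indicator fun x => exp (-(‖x‖ ^ 2) / 2)) =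
        fun x => (S.indicator fun r => exp (-(r ^ 2) / 2)) ‖x‖ := by
      funext x
      simp [Set.indicator]
    rw [e, integral_fun_norm_addHaar volume (S.indicator fun r => exp (-(r ^ 2) / 2)), hdim,
      nsmul_eq_mul, smul_eq_mul, hV, mul_assoc, mul_assoc]
    congr 3
    rw [← setIntegral_indicator hS]
    refine setIntegral_congr_fun measurableSet_Ioi fun r _ => ?_
    by_cases h : r ∈ S <;> simp [h]
  -- Total mass 1 identifies the constant `V`, so the volume of the ball need not be computed.
  have h1 := key Set.univ MeasurableSet.univ
  have h2 := key (Set.Ioi R) measurableSet_Ioi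
  have e : Set.Ioi (0 : ℝ) ∩ Set.Ioi R = Set.Ioi R :=
    Set.inter_eq_right.2 (Set.Ioi_subset_Ioi hR)
  rw [e] at h2
  simp only [Set.mem_univ, Set.ofPred_true, probReal_univ, Set.inter_univ] at h1
  have h3 : (stdGaussian (EuclideanSpace ℝ (Fin n))).real {x | R < ‖x‖} = V * _ := h2
  rw [h3, mul_right_comm, ← h1, one_mul]

/-- The upper tail of the `χ²` distribution. -/
theorem stdGaussian_norm_gt_le (n : ℕ) (hn : 2 ≤ n) :
    (stdGaussian (EuclideanSpace ℝ (Fin n))).real {x | √(n + 2 * √(n * log n)) < ‖x‖} ≤ 1 / n := by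
  have hn0 : (0 : ℝ) < n := by exact_mod_cast (by omega : 0 < n)
  have h1 := stdGaussian_norm_gt n (by omega) (sqrt_nonneg (n + 2 * √(n * log n)))
  have h2 := radial_ratio_le n hn
  rw [← h1] at h2
  have hJ : 0 < ∫ r in Set.Ioi (0 : ℝ), r ^ (n - 1) * exp (-(r ^ 2) / 2) := by
    rw [integral_pow_mul_exp n (by omega)]
    have := Gamma_pos_of_pos (by positivity : (0 : ℝ) < n / 2)
    positivity
  rw [le_div_iff₀ hn0]
  refine le_of_mul_le_mul_right ?_ hJ
  linarith

/-- The two-sided Gaussian tail estimate. -/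
theorem gaussianReal_abs_gt_le {u : ℝ} (hu : 0 < u) :
    (gaussianReal 0 1).real {x | u < |x|} ≤ 2 * exp (-(u ^ 2) / 2) / (u * √(2 * π)) := by
  have hpos : (gaussianReal 0 1).real (Set.Ioi u) ≤ exp (-(u ^ 2) / 2) / (u * √(2 * π)) := by
    have hd : ∀ x ∈ Set.Ici u, HasDerivAt (fun r : ℝ => -exp (-(r ^ 2) / 2))
        (x * exp (-(x ^ 2) / 2)) x := by
      intro x _
      have h1 : HasDerivAt (fun r : ℝ => -(r ^ 2) / 2) (-x) x := by
        have := ((hasDerivAt_pow 2 x).neg).div_const 2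
        convert! this using 1; simp; ring
      convert! h1.exp.neg using 1
      ring
    have hnn : ∀ x ∈ Set.Ioi u, 0 ≤ x * exp (-(x ^ 2) / 2) := fun x hx =>
      mul_nonneg (hu.le.trans (le_of_lt hx)) (exp_pos _).le
    have ht : Filter.Tendsto (fun r : ℝ => -exp (-(r ^ 2) / 2)) Filter.atTop (nhds 0) := by
      simpa using tendsto_pow_mul_exp 0
    have hint := integrableOn_Ioi_deriv_of_nonneg' hd hnn ht
    have heq := integral_Ioi_of_hasDerivAt_of_nonneg' hd hnn ht
    rw [measureReal_def, gaussianReal_apply_eq_integral 0 one_ne_zero,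
      ENNReal.toReal_ofReal (integral_nonneg fun x => gaussianPDFReal_nonneg 0 1 x)]
    -- Inserting x/u ≥ 1 makes the integrand an exact derivative.
    calc ∫ x in Set.Ioi u, gaussianPDFReal 0 1 x
        ≤ ∫ x in Set.Ioi u, (u * √(2 * π))⁻¹ * (x * exp (-(x ^ 2) / 2)) := by
          refine integral_mono_of_nonneg (Filter.Eventually.of_forall fun x =>
            gaussianPDFReal_nonneg 0 1 x) (hint.const_mul _) ?_
          filter_upwards [ae_restrict_mem measurableSet_Ioi] with x hx
          have hx' : u < x := hx
          have e : (u * √(2 * π))⁻¹ * (x * exp (-(x ^ 2) / 2)) =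
            (x / u) * ((√(2 * π))⁻¹ * exp (-(x ^ 2) / 2)) := by field_simp
          rw [e, gaussianPDFReal]
          simp only [sub_zero, NNReal.coe_one, mul_one]
          exact le_mul_of_one_le_left (by positivity) ((one_le_div hu).2 hx'.le)
      _ = _ := by
          rw [integral_const_mul, heq, zero_sub, neg_neg]; field_simp
  have hneg : (gaussianReal 0 1).real (Set.Iio (-u)) = (gaussianReal 0 1).real (Set.Ioi u) := by
    have h : (gaussianReal 0 1).map (fun x : ℝ => -x) = gaussianReal 0 1 := by
      rw [gaussianReal_map_neg, neg_zero]
    conv_lhs => rw [← h]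
    rw [map_measureReal_apply measurable_neg measurableSet_Iio]
    congr 1
    ext x; simp
  have hset : {x : ℝ | u < |x|} = Set.Ioi u ∪ Set.Iio (-u) := by
    ext x
    simp only [Set.mem_ofPred_eq, Set.mem_union, Set.mem_Ioi, Set.mem_Iio, lt_abs]
    constructor <;> rintro (h | h) <;> [left; right; left; right] <;> linarith
  rw [hset]
  refine (measureReal_union_le _ _).trans ?_
  rw [hneg, mul_div_assoc]; linarith

/-- The noise is a scaled standard Gaussian vector. -/
theorem gaussianNoise_eq_map (M : ℕ) (σ : ℝ≥0) :
    gaussianNoise M σ = (stdGaussian (EuclideanSpace ℝ (Fin M))).map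
      fun (x : EuclideanSpace ℝ (Fin M)) (i : Fin M) => (σ : ℝ) * x i := by
  rw [← map_pi_eq_stdGaussian, Measure.map_map (by fun_prop) (by fun_prop), gaussianNoise]
  have h1 : gaussianReal 0 (σ ^ 2) = (gaussianReal 0 1).map fun x => (σ : ℝ) * x := by
    rw [gaussianReal_map_const_mul, mul_zero, mul_one]
    congr 1
  simp only [h1]
  exact (Measure.pi_map_pi (μ := fun _ : Fin M => gaussianReal 0 1)
    (f := fun _ x => (σ : ℝ) * x) (fun _ => by fun_prop)).symm

/-- The probability that Gaussian noise leaves the `ℓ₂` ball. -/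
theorem gaussianNoise_setB₂_compl_le (M : ℕ) (hM : 2 ≤ M) (σ : ℝ≥0) :
    (gaussianNoise M σ).real (setB₂ M σ)ᶜ ≤ 1 / M := by
  rw [gaussianNoise_eq_map, map_measureReal_apply (by fun_prop)
    (isClosed_setB₂ M σ).measurableSet.compl]
  refine (measureReal_mono fun x hx => ?_).trans (stdGaussian_norm_gt_le M hM)
  by_contra h
  refine hx ?_
  simp only [Set.mem_ofPred_eq, not_lt] at h
  have h2 := pow_le_pow_left₀ (norm_nonneg x) h 2
  rw [sq_sqrt (by positivity)] at h2
  have e : lpNorm 2 (fun i => (σ : ℝ) * x i) ^ 2 = σ ^ 2 * ‖x‖ ^ 2 := by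
    rw [lpNorm_two_sq, EuclideanSpace.real_norm_sq_eq, Finset.mul_sum]
    exact Finset.sum_congr rfl fun i _ => by ring
  rw [setB₂, Set.mem_ofPred_eq, e]
  gcongr

/-- The tail of a linear functional of the standard Gaussian vector. -/
theorem stdGaussian_inner_gt_le {n : ℕ} (a : EuclideanSpace ℝ (Fin n)) {K u : ℝ} (hK : 0 < K)
    (ha : ‖a‖ ≤ K) (hu : 0 < u) :
    (stdGaussian (EuclideanSpace ℝ (Fin n))).real {x | K * u < |inner ℝ a x|} ≤
      2 * exp (-(u ^ 2) / 2) / (u * √(2 * π)) := by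
  have hlaw : (stdGaussian (EuclideanSpace ℝ (Fin n))).map (innerSL ℝ a) =
      (gaussianReal 0 1).map fun x => ‖a‖ * x := by
    rw [IsGaussian.map_eq_gaussianReal, integral_strongDual_stdGaussian, variance_dual_stdGaussian,
      innerSL_apply_norm, gaussianReal_map_const_mul, mul_zero, mul_one]
    congr 1
    ext
    simp
  have hm : MeasurableSet {y : ℝ | K * u < |y|} :=
    measurableSet_lt measurable_const measurable_abs
  have h1 : (stdGaussian (EuclideanSpace ℝ (Fin n))).real {x | K * u < |inner ℝ a x|} =
      ((stdGaussian (EuclideanSpace ℝ (Fin n))).map (innerSL ℝ a)).real {y | K * u < |y|} := by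
    rw [map_measureReal_apply (by fun_prop) hm]; rfl
  rw [h1, hlaw, map_measureReal_apply (by fun_prop) hm]
  refine (measureReal_mono fun y hy => ?_).trans (gaussianReal_abs_gt_le hu)
  simp only [Set.mem_preimage, Set.mem_ofPred_eq, abs_mul, abs_norm] at hy ⊢
  have : ‖a‖ * |y| ≤ K * |y| := by gcongr
  exact lt_of_mul_lt_mul_left (hy.trans_le this) hK.le

/-- The probability that Gaussian noise leaves the Dantzig type constraint set. -/
theorem gaussianNoise_setB₃_compl_le {M N d : ℕ} (hd : 2 ≤ d) (Φ : Matrix (Fin M) (Fin N) ℝ)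
    (D : Matrix (Fin N) (Fin d) ℝ) (σ : ℝ≥0)
    (hcol : ∀ i, lpNorm 2 (Φ *ᵥ (D *ᵥ Pi.single i 1)) ≤ √2) :
    (gaussianNoise M σ).real (setB₃ Φ D σ)ᶜ ≤ 1 / (d * √(2 * π * log d)) := by
  have hd0 : (0 : ℝ) < d := by exact_mod_cast (by omega : 0 < d)
  have hlog : 0 < log d := log_pos (by exact_mod_cast (by omega : 1 < d))
  rw [gaussianNoise_eq_map, map_measureReal_apply (by fun_prop)
    (isClosed_setB₃ Φ D σ).measurableSet.compl]
  -- Coordinates of D*Φ*z have standard deviation at most √2σ, so the threshold 2√2σ√(log d) is `u`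
  -- such deviations. As exp(−u²/2) = d⁻², the union over `d` indices leaves one factor 1/d.
  set u := 2 * √(log d) with hu
  have hu0 : 0 < u := by positivity
  let a : Fin d → EuclideanSpace ℝ (Fin M) := fun i => WithLp.toLp 2 (Φ *ᵥ (D *ᵥ Pi.single i 1))
  have hsub : (fun (x : EuclideanSpace ℝ (Fin M)) i => (σ : ℝ) * x i) ⁻¹' (setB₃ Φ D σ)ᶜ ⊆
      ⋃ i, {x | √2 * u < |inner ℝ (a i) x|} := by
    intro x hx
    by_contra h
    simp only [Set.mem_iUnion, Set.mem_ofPred_eq, not_exists, not_lt] at h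
    refine hx ?_
    have hb : lpNorm ∞ (Dᵀ *ᵥ (Φᵀ *ᵥ fun i => (σ : ℝ) * x i)) ≤ σ * (√2 * u) := by
      refine lpNorm_top_le _ (by positivity) fun i => ?_
      have e : (Dᵀ *ᵥ (Φᵀ *ᵥ fun i => (σ : ℝ) * x i)) i = σ * inner ℝ (a i) x := by
        have e1 := dotProduct_transpose_mulVec D (Pi.single i 1) (Φᵀ *ᵥ fun i => (σ : ℝ) * x i)
        rw [single_one_dotProduct, dotProduct_transpose_mulVec] at e1
        rw [e1]
        simp only [dotProduct, a, PiLp.inner_apply, Finset.mul_sum]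
        refine Finset.sum_congr rfl fun j _ => ?_
        simp
        ring
      rw [e, abs_mul, abs_of_nonneg σ.coe_nonneg]
      exact mul_le_mul_of_nonneg_left (h i) σ.coe_nonneg
    have h2 := pow_le_pow_left₀ (norm_nonneg (WithLp.toLp ∞ _)) hb 2
    refine h2.trans (le_of_eq ?_)
    rw [hu, mul_pow, mul_pow, mul_pow, sq_sqrt (by norm_num), sq_sqrt hlog.le]; ring
  refine (measureReal_mono hsub).trans ((measureReal_iUnion_fintype_le _).trans ?_)
  refine (Finset.sum_le_sum fun i _ => stdGaussian_inner_gt_le (a i) (by positivity) (hcol i)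
    hu0).trans (le_of_eq ?_)
  have he : exp (-(u ^ 2) / 2) = ((d : ℝ) ^ 2)⁻¹ := by
    rw [hu, mul_pow, sq_sqrt hlog.le, show -(2 ^ 2 * log d) / 2 = -(2 * log d) by ring, exp_neg,
      two_mul, exp_add, exp_log hd0, sq]
  rw [Finset.sum_const, Finset.card_univ, Fintype.card_fin, nsmul_eq_mul, he, hu,
    sqrt_mul (by positivity : 0 ≤ 2 * π)]
  field_simp

end Gaussian

/-! ### From noise events to the theorem. -/

instance (M : ℕ) (σ : ℝ≥0) : IsProbabilityMeasure (gaussianNoise M σ) := by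
  unfold gaussianNoise; infer_instance

/-- A property that holds on a closed set of noise vectors of large probability. -/
theorem holdsWithProb_of_law {Ω : Type*} [MeasurableSpace Ω] {μ : Measure Ω} {M : ℕ} {σ : ℝ≥0}
    {z : Ω → Fin M → ℝ} (hz : HasLaw z (gaussianNoise M σ) μ) {B : Set (Fin M → ℝ)}
    (hB : IsClosed B) {q : ℝ} (hq : (gaussianNoise M σ).real Bᶜ ≤ q) {P : Ω → Prop}
    (hP : ∀ ω, z ω ∈ B → P ω) : HoldsWithProb μ (1 - q) P := by
  -- `z` is only a.e. measurable, so the event is a measurable subset of the preimage with the same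
  -- measure.
  obtain ⟨E, hEB, hE, hEae⟩ :=
    (hz.aemeasurable.nullMeasurableSet_preimage hB.measurableSet).exists_measurable_subset_ae_eq
  refine ⟨E, hE, ?_, fun ω hω => hP ω (hEB hω)⟩
  have h1 : μ.real E = (gaussianNoise M σ).real B := by
    rw [measureReal_congr hEae, measureReal_def, measureReal_def, ← hz.map_eq,
      Measure.map_apply_of_aemeasurable hz.aemeasurable hB.measurableSet]
  rw [h1]
  have h2 := probReal_compl_eq_one_sub (μ := gaussianNoise M σ) hB.measurableSet
  linarith

theorem DRIP.lpNorm_col_le {M N d m : ℕ} {Φ : Matrix (Fin M) (Fin N) ℝ}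
    {D : Matrix (Fin N) (Fin d) ℝ} {δ : ℝ} (h : DRIP Φ D m δ) (hD : IsTightFrame D) (hm : 1 ≤ m)
    (hδ1 : δ ≤ 1) (i : Fin d) : lpNorm 2 (Φ *ᵥ (D *ᵥ Pi.single i 1)) ≤ √2 := by
  have hsp : IsSparse m (Pi.single i 1 : Fin d → ℝ) := by
    refine le_trans (Finset.card_le_card (t := {i}) fun j hj => ?_) (by simpa using hm)
    by_contra hne
    simp only [Finset.mem_singleton] at hne
    exact (Finset.mem_filter.1 hj).2 (by simp [hne])
  have h1 : lpNorm 2 (D *ᵥ Pi.single i 1) ≤ 1 := by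
    rw [lpNorm_two]
    refine Real.sqrt_le_one.2 ((hD.dotProduct_mulVec_le _).trans (le_of_eq ?_))
    rw [Finset.sum_eq_single i] <;> simp +contextual
  calc _ ≤ √(1 + δ) * lpNorm 2 (D *ᵥ Pi.single i 1) := (h _ hsp).2
    _ ≤ √2 * 1 := mul_le_mul (Real.sqrt_le_sqrt (by linarith)) h1 (lpNorm_two_nonneg _)
        (Real.sqrt_nonneg _)
    _ = √2 := mul_one _

end L1Analysis

theorem theorem3p2 {Ω : Type*} [MeasurableSpace Ω] (μ : MeasureTheory.Measure Ω)
    [MeasureTheory.IsProbabilityMeasure μ]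
    {M N d : ℕ} (hM : 1 ≤ M)
    (Φ : Matrix (Fin M) (Fin N) ℝ) (D : Matrix (Fin N) (Fin d) ℝ)
    (hD : L1Analysis.IsTightFrame D)
    (s : ℕ) (t : ℝ) (ht0 : 0 < t) (ht : t < 4 / 3) (hts : 1 < t * s)
    (δ : ℝ) (hδ_def : δ = L1Analysis.dripConstReal Φ D (t * s)) (hδ : δ < t / (4 - t))
    (σ : ℝ≥0) (z : Ω → Fin M → ℝ)
    (hz : ProbabilityTheory.HasLaw z (L1Analysis.gaussianNoise M σ) μ)
    (f : Fin N → ℝ) (xs : Fin d → ℝ) (hxs : L1Analysis.IsBestApprox s (Dᵀ *ᵥ f) xs) :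
    L1Analysis.HoldsWithProb μ (1 - 1 / M) (fun ω =>
        (∃ g, L1Analysis.IsL1AnalysisSolution Φ D (Φ *ᵥ f + z ω) (L1Analysis.setB₂ M σ) g) ∧
        ∀ g, L1Analysis.IsL1AnalysisSolution Φ D (Φ *ᵥ f + z ω) (L1Analysis.setB₂ M σ) g →
          L1Analysis.lpNorm 2 (g - f) ≤
            L1Analysis.constA t δ * σ * √(M + 2 * √(M * Real.log M)) +
              L1Analysis.constB t δ * (L1Analysis.lpNorm 1 (Dᵀ *ᵥ f - xs) / √s)) ∧
    (2 ≤ d →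
      L1Analysis.HoldsWithProb μ (1 - 1 / (d * √(2 * Real.pi * Real.log d))) (fun ω =>
        (∃ g, L1Analysis.IsL1AnalysisSolution Φ D (Φ *ᵥ f + z ω) (L1Analysis.setB₃ Φ D σ) g) ∧
        ∀ g, L1Analysis.IsL1AnalysisSolution Φ D (Φ *ᵥ f + z ω) (L1Analysis.setB₃ Φ D σ) g →
          L1Analysis.lpNorm 2 (g - f) ≤
            2 * √2 * L1Analysis.constC s t δ * σ * √(Real.log d) +
              L1Analysis.constB t δ * (L1Analysis.lpNorm 1 (Dᵀ *ᵥ f - xs) / √s))) := by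
  have hs : 1 ≤ s := by
    rcases Nat.eq_zero_or_pos s with rfl | h
    · norm_num at hts
    · exact h
  obtain ⟨hδ0, hdrip⟩ := L1Analysis.dRIP_dripConst Φ D ⌈t * s⌉₊
  have hδe : L1Analysis.dripConst Φ D ⌈t * s⌉₊ = δ := hδ_def.symm
  rw [hδe] at hδ0 hdrip
  refine ⟨?_, fun hd => ?_⟩
  · rcases Nat.lt_or_ge M 2 with hM2 | hM2
    -- The claimed probability is 0, and the empty event serves.
    · obtain rfl : M = 1 := by omega
      exact ⟨∅, MeasurableSet.empty, by simp, fun ω h => h.elim⟩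
    · exact L1Analysis.holdsWithProb_of_law hz (L1Analysis.isClosed_setB₂ M σ)
        (L1Analysis.gaussianNoise_setB₂_compl_le M hM2 σ) fun ω hω =>
          L1Analysis.recovery_setB₂ hD hs ht0 ht hts hδ0 hδ hdrip f xs hxs.1 hω
  · have hδ1 : δ ≤ 1 := by
      refine hδ.le.trans ?_
      rw [div_le_one (by linarith)]; linarith
    exact L1Analysis.holdsWithProb_of_law hz (L1Analysis.isClosed_setB₃ Φ D σ)
      (L1Analysis.gaussianNoise_setB₃_compl_le hd Φ D σ fun i =>
        hdrip.lpNorm_col_le hD (one_le_two.trans (L1Analysis.two_le_ceil hts)) hδ1 i) fun ω hω =>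
          L1Analysis.recovery_setB₃ hD hs ht0 ht hts hδ0 hδ hdrip f xs hxs.1 hω
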